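/- **Setting.** Type $G_2$ with Cartan matrix $(\langle h_i,\alpha_j\rangle)=\begin{pmatrix}2&-3\\-1&2\end{pmatrix}$ and fundamental weights $\Lambda_1,\Lambda_2$. Crystals are multiplied with Kashiwara's rule: $\tilde f_i(b_1\otimes b_2)=\tilde f_ib_1\otimes b_2$ if $\varphi_i(b_1)>\varepsilon_i(b_2)$ and $b_1\otimes\tilde f_ib_2$ otherwise; $\tilde e_i(b_1\otimes b_2)=\tilde e_ib_1\otimes b_2$ if $\varphi_i(b_1)\ge\varepsilon_i(b_2)$ and $b_1\otimes\tilde e_ib_2$ otherwise. **Monomials.** Let $\mathcal M$ be the set of Laurent monomials in commuting variables $Y_i(k)$, $i=1,2$, $k\in\mathbb Z$. For $M=\prod Y_i(k)^{y_i(k)}$ put $\mathrm{wt}(M)=\sum_{i,k}y_i(k)\Lambda_i$, $\varphi_i(M)=\max_{k\in\mathbb Z}\sum_{l\le k}y_i(l)$, $\varepsilon_i(M)=\max_{k\in\mathbb Z}\bigl(-\sum_{l>k}y_i(l)\bigr)$, and let $n_f$ (resp. $n_e$) be the smallest (resp. largest) $k\in\mathbb Z$ with $\sum_{l\le k}y_i(l)=\varphi_i(M)$.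 With $A_1(k)=Y_1(k)Y_1(k+1)Y_2(k)^{-1}$ and $A_2(k)=Y_2(k)Y_2(k+1)Y_1(k+1)^{-3}$, put $\tilde f_iM=A_i(n_f)^{-1}M$ if $\varphi_i(M)>0$ and $\tilde f_iM=0$ otherwise; $\tilde e_iM=A_i(n_e)M$ if $\varepsilon_i(M)>0$ and $\tilde e_iM=0$ otherwise. For $\lambda=m\Lambda_1+n\Lambda_2$ with $m,n\in\mathbb Z_{\ge0}$, $\mathcal M(\lambda)$ is the connected component of the crystal $\mathcal M$ containing $Y_1(1)^mY_2(1)^n$. Put $X_1(k)=Y_1(k)$, $X_2(k)=Y_1(k+1)^{-1}Y_2(k)$, $X_3(k)=Y_1(k+1)^2Y_2(k+1)^{-1}$, $X_0(k)=Y_1(k+1)Y_1(k+2)^{-1}$, $X_{\bar3}(k)=Y_1(k+2)^{-2}Y_2(k+1)$, $X_{\bar2}(k)=Y_1(k+2)Y_2(k+2)^{-1}$, $X_{\bar1}(k)=Y_1(k+3)^{-1}$. **Tableaux.** Order the letters by $1\prec2\prec3\prec0\prec\bar3\prec\bar2\prec\bar1$ and let $\mathrm{dist}(a,b)$ be the difference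 of the positions of $a,b$ in this order. $S(\lambda)$ is the set of pairs of rows $a_n,\dots,a_1$ (top) and $b_{m+n},\dots,b_1$ (bottom), written from left to right and right justified, such that: 1. $a_n\preceq\cdots\preceq a_1$ and $b_{m+n}\preceq\cdots\preceq b_1$, and $0$ occurs at most once in each row; 2. $a_j\prec b_j$ or $a_j=b_j=0$, for $1\le j\le n$; 3. $\mathrm{dist}(a_j,b_j)\le2$ if $a_j\in\{1,0\}$, and $\mathrm{dist}(a_j,b_j)\le3$ otherwise, for $1\le j\le n$; 4. $\mathrm{dist}(a_j,b_{j-1})\ge3$ if $a_j\in\{2,3,0\}$, and $\mathrm{dist}(a_j,b_{j-1})\ge2$ if $a_j=\bar3$, for $2\le j\le n$. Let $B(\Lambda_1)$ be the crystal $1\xrightarrow{1}2\xrightarrow{2}3\xrightarrow{1}0\xrightarrow{1}\bar3\xrightarrow{2}\bar2\xrightarrow{1}\bar1$, and realize $B(\Lambda_2)$ as the connected component of $1\otimes2$ in $B(\Lambda_1)\otimes B(\Lambda_1)$, so that the column with $a$ above $b$ is $a\otimes b$. Reading columns from right to left gives an injection $$\iota:S(\lambda)\to B(\Lambda_2)^{\otimes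 n}\otimes B(\Lambda_1)^{\otimes m},\qquad T\mapsto (a_1\otimes b_1)\otimes\cdots\otimes(a_n\otimes b_n)\otimes b_{n+1}\otimes\cdots\otimes b_{m+n},$$ and $S(\lambda)$ carries the crystal structure induced through $\iota$. **Theorem.** Let $\lambda=m\Lambda_1+n\Lambda_2$ be a dominant integral weight. Then $\iota$ commutes with all $\tilde e_i,\tilde f_i$ and preserves $\mathrm{wt},\varepsilon_i,\varphi_i$, and its image is the connected component of $(1\otimes2)^{\otimes n}\otimes1^{\otimes m}$, that is, the copy of $B(\lambda)$ in $B(\Lambda_2)^{\otimes n}\otimes B(\Lambda_1)^{\otimes m}$. Moreover there is a crystal isomorphism $\psi:\mathcal M(\lambda)\to S(\lambda)$ (a bijection that preserves $\mathrm{wt},\varepsilon_i,\varphi_i$ and commutes with $\tilde e_i,\tilde f_i$) such that for all $M\in\mathcal M(\lambda)$ and $T\in S(\lambda)$ with rows $(a_j)$, $(b_j)$, $$\psi(M)=T\iff M=X_{a_1}(2)\cdots X_{a_n}(2)\,X_{b_1}(1)\cdots X_{b_{m+n}}(1).$$ In particular every $M\in\mathcal M(\lambda)$ has exactly one such expression satisfying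 1–4 (its normal form), and $\psi$ sends $M$ to the tableau with top row $a_n,\dots,a_1$ and bottom row $b_{m+n},\dots,b_1$. -/

import Mathlib

namespace G2

/-! ### Crystals of type `G₂`

The index `0 : Fin 2` stands for `i = 1` and `1 : Fin 2` stands for `i = 2`. -/

/-- The Cartan matrix `a i j = ⟨h i, α j⟩` of type `G₂`. -/
def cartan : Matrix (Fin 2) (Fin 2) ℤ := !![2, -3; -1, 2]

/-- The weight lattice `ℤ Λ₁ ⊕ ℤ Λ₂`; the coordinate `w i` is `⟨h i, w⟩`. -/
abbrev Weight := Fin 2 → ℤ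

/-- The simple root `α i` written in the basis of the fundamental weights. -/
def root (i : Fin 2) : Weight := fun j => cartan j i

/-- A crystal of type `G₂` (with finite `ε` and `φ`); the value `none` of a Kashiwara operator
stands for `0`. The rules for `wt`, `ε`, `φ` along `f i` follow from those along `e i`
and `f_iff`. -/
structure Crystal (B : Type*) where
  wt : B → Weight
  ε : Fin 2 → B → ℤ
  φ : Fin 2 → B → ℤ
  e : Fin 2 → B → Option B
  f : Fin 2 → B → Option B
  φ_eq : ∀ i b, φ i b = ε i b + wt b i
  wt_e : ∀ i b c, e i b = some c → wt c = wt b + root i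
  ε_e : ∀ i b c, e i b = some c → ε i c = ε i b - 1
  φ_e : ∀ i b c, e i b = some c → φ i c = φ i b + 1
  f_iff : ∀ i b c, f i b = some c ↔ e i c = some b

lemma root_self (i : Fin 2) : root i i = 2 := by fin_cases i <;> simp [root, cartan]

namespace Crystal

variable {A B D : Type*}

/-- A map that preserves `wt`, `ε`, `φ` and commutes with all Kashiwara operators.
A bijective one is a crystal isomorphism. -/
structure IsStrictMorphism (C : Crystal A) (C' : Crystal B) (g : A → B) : Prop where
  wt : ∀ a, C'.wt (g a) = C.wt a
  ε : ∀ i a, C'.ε i (g a) = C.ε i a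
  φ : ∀ i a, C'.φ i (g a) = C.φ i a
  e : ∀ i a, C'.e i (g a) = (C.e i a).map g
  f : ∀ i a, C'.f i (g a) = (C.f i a).map g

/-- `b` and `c` lie in the same connected component of the crystal graph, whose arrows are
`b ⟶ c` whenever `f i b = c` for some `i`. -/
def Connected (C : Crystal B) : B → B → Prop :=
  Relation.EqvGen fun b c => ∃ i, C.f i b = some c

/-- The underlying set of the connected component of `b`. -/
abbrev Component (C : Crystal B) (b : B) : Type _ := {c : B // C.Connected b c}

lemma Connected.of_f {C : Crystal B} {b c d : B} {i : Fin 2} (h : C.Connected b c)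
    (hf : C.f i c = some d) : C.Connected b d :=
  .trans _ _ _ h (.rel _ _ ⟨i, hf⟩)

lemma Connected.of_e {C : Crystal B} {b c d : B} {i : Fin 2} (h : C.Connected b c)
    (he : C.e i c = some d) : C.Connected b d :=
  .trans _ _ _ h (.symm _ _ (.rel _ _ ⟨i, (C.f_iff i d c).2 he⟩))

open Classical in
/-- The crystal structure induced on `A` by an injection `g : A → B` into a crystal: the crystal
graph of `A` is the full subgraph of that of `B` on the image of `g`. -/
noncomputable def pullback (C : Crystal B) (g : A → B) (hg : Function.Injective g) :
    Crystal A where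
  wt a := C.wt (g a)
  ε i a := C.ε i (g a)
  φ i a := C.φ i (g a)
  e i a := if h : ∃ a', C.e i (g a) = some (g a') then some h.choose else none
  f i a := if h : ∃ a', C.f i (g a) = some (g a') then some h.choose else none
  φ_eq i a := C.φ_eq i (g a)
  wt_e i a c h := by
    split_ifs at h with h'
    cases h
    exact C.wt_e _ _ _ h'.choose_spec
  ε_e i a c h := by
    split_ifs at h with h'
    cases h
    exact C.ε_e _ _ _ h'.choose_spec
  φ_e i a c h := by
    split_ifs at h with h'
    cases h
    exact C.φ_e _ _ _ h'.choose_spec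
  f_iff i a c := by
    constructor
    · intro h
      split_ifs at h with h'
      cases h
      have h1 := (C.f_iff _ _ _).1 h'.choose_spec
      have h2 : ∃ a', C.e i (g h'.choose) = some (g a') := ⟨a, h1⟩
      rw [dif_pos h2]
      congr 1
      apply hg
      exact (Option.some.inj (h1.symm.trans h2.choose_spec)).symm
    · intro h
      split_ifs at h with h'
      cases h
      have h1 := (C.f_iff _ _ _).2 h'.choose_spec
      have h2 : ∃ a', C.f i (g h'.choose) = some (g a') := ⟨c, h1⟩
      rw [dif_pos h2]
      congr 1
      apply hg
      exact (Option.some.inj (h1.symm.trans h2.choose_spec)).symm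

/-- The connected component of `b`, as a crystal. -/
noncomputable def component (C : Crystal B) (b : B) : Crystal (C.Component b) :=
  C.pullback Subtype.val Subtype.val_injective

/-- The inclusion of a connected component commutes with the Kashiwara operators. -/
lemma component_strict (C : Crystal B) (b : B) :
    IsStrictMorphism (C.component b) C Subtype.val where
  wt _ := rfl
  ε _ _ := rfl
  φ _ _ := rfl
  e i a := by
    simp only [component, pullback]
    split_ifs with h
    · simpa using h.choose_spec
    · rcases he : C.e i a.1 with _ | c
      · rfl
      · exact absurd ⟨⟨c, a.2.of_e he⟩, he⟩ h
  f i a := by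
    simp only [component, pullback]
    split_ifs with h
    · simpa using h.choose_spec
    · rcases he : C.f i a.1 with _ | c
      · rfl
      · exact absurd ⟨⟨c, a.2.of_f he⟩, he⟩ h

/-- The crystal with one element, of weight `0`. -/
def unit : Crystal Unit where
  wt _ := 0
  ε _ _ := 0
  φ _ _ := 0
  e _ _ := none
  f _ _ := none
  φ_eq := by simp
  wt_e := by simp
  ε_e := by simp
  φ_e := by simp
  f_iff := by simp

/-- The tensor product of crystals; `(b₁, b₂)` stands for `b₁ ⊗ b₂`. -/
def tensor (C : Crystal A) (C' : Crystal B) : Crystal (A × B) where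
  wt b := C.wt b.1 + C'.wt b.2
  ε i b := max (C.ε i b.1) (C'.ε i b.2 - C.wt b.1 i)
  φ i b := max (C'.φ i b.2) (C.φ i b.1 + C'.wt b.2 i)
  e i b := if C'.ε i b.2 ≤ C.φ i b.1 then (C.e i b.1).map (fun c => (c, b.2))
    else (C'.e i b.2).map (fun c => (b.1, c))
  f i b := if C'.ε i b.2 < C.φ i b.1 then (C.f i b.1).map (fun c => (c, b.2))
    else (C'.f i b.2).map (fun c => (b.1, c))
  φ_eq i b := by
    have h1 := C.φ_eq i b.1
    have h2 := C'.φ_eq i b.2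
    simp only [Pi.add_apply]
    omega
  wt_e i b c h := by
    split_ifs at h with h'
    · obtain ⟨x, hx, rfl⟩ := Option.map_eq_some_iff.1 h
      simp only [C.wt_e _ _ _ hx]
      abel
    · obtain ⟨x, hx, rfl⟩ := Option.map_eq_some_iff.1 h
      simp only [C'.wt_e _ _ _ hx]
      abel
  ε_e i b c h := by
    have h1 := C.φ_eq i b.1
    have h2 := C'.φ_eq i b.2
    split_ifs at h with h'
    · obtain ⟨x, hx, rfl⟩ := Option.map_eq_some_iff.1 h
      have h3 := C.wt_e _ _ _ hx
      simp only [C.ε_e _ _ _ hx, h3, Pi.add_apply, root_self]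
      omega
    · obtain ⟨x, hx, rfl⟩ := Option.map_eq_some_iff.1 h
      simp only [C'.ε_e _ _ _ hx]
      omega
  φ_e i b c h := by
    have h1 := C.φ_eq i b.1
    have h2 := C'.φ_eq i b.2
    split_ifs at h with h'
    · obtain ⟨x, hx, rfl⟩ := Option.map_eq_some_iff.1 h
      simp only [C.φ_e _ _ _ hx]
      omega
    · obtain ⟨x, hx, rfl⟩ := Option.map_eq_some_iff.1 h
      have h3 := C'.wt_e _ _ _ hx
      simp only [C'.φ_e _ _ _ hx, h3, Pi.add_apply, root_self]
      omega
  f_iff i b c := by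
    constructor
    · intro h
      split_ifs at h with h'
      · obtain ⟨x, hx, rfl⟩ := Option.map_eq_some_iff.1 h
        have h1 := (C.f_iff _ _ _).1 hx
        have h2 := C.φ_e _ _ _ h1
        rw [if_pos (show C'.ε i b.2 ≤ C.φ i x by omega), h1]
        rfl
      · obtain ⟨x, hx, rfl⟩ := Option.map_eq_some_iff.1 h
        have h1 := (C'.f_iff _ _ _).1 hx
        have h2 := C'.ε_e _ _ _ h1
        rw [if_neg (show ¬ C'.ε i x ≤ C.φ i b.1 by omega), h1]
        rfl
    · intro h
      split_ifs at h with h'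
      · obtain ⟨x, hx, rfl⟩ := Option.map_eq_some_iff.1 h
        have h1 := (C.f_iff _ _ _).2 hx
        have h2 := C.φ_e _ _ _ hx
        rw [if_pos (show C'.ε i c.2 < C.φ i x by omega), h1]
        rfl
      · obtain ⟨x, hx, rfl⟩ := Option.map_eq_some_iff.1 h
        have h1 := (C'.f_iff _ _ _).2 hx
        have h2 := C'.ε_e _ _ _ hx
        rw [if_neg (show ¬ C'.ε i x < C.φ i c.1 by omega), h1]
        rfl

end Crystal

/-- The underlying set of the `k`-th tensor power. -/
def TPow (B : Type) : ℕ → Type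
  | 0 => Unit
  | k + 1 => B × TPow B k

/-- The element `b 0 ⊗ b 1 ⊗ ⋯ ⊗ b (k - 1)` of the `k`-th tensor power. -/
def TPow.ofFn {B : Type} : {k : ℕ} → (Fin k → B) → TPow B k
  | 0, _ => ()
  | _ + 1, b => (b 0, TPow.ofFn fun j => b j.succ)

lemma TPow.ofFn_injective {B : Type} : ∀ {k : ℕ}, Function.Injective (@TPow.ofFn B k)
  | 0, _, _, _ => funext fun j => j.elim0
  | k + 1, b, c, h => by
    have h0 : b 0 = c 0 := congrArg Prod.fst h
    have h1 := TPow.ofFn_injective (congrArg Prod.snd h)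
    funext j
    refine Fin.cases h0 (fun l => congrFun h1 l) j

/-- The `k`-th tensor power of a crystal. -/
def Crystal.power {B : Type} (C : Crystal B) : (k : ℕ) → Crystal (TPow B k)
  | 0 => Crystal.unit
  | k + 1 => C.tensor (C.power k)

/-! ### The crystals `B(Λ₁)` and `B(Λ₂)` -/

/-- The letters `1, 2, 3, 0, 3̄, 2̄, 1̄`. -/
inductive Letter
  | one | two | three | zero | bar3 | bar2 | bar1
  deriving DecidableEq

namespace Letter

instance : Fintype Letter :=
  ⟨{one, two, three, zero, bar3, bar2, bar1}, fun a => by cases a <;> decide⟩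

/-- The position in the order `1 ≺ 2 ≺ 3 ≺ 0 ≺ 3̄ ≺ 2̄ ≺ 1̄`. -/
def rank : Letter → ℕ
  | one => 1 | two => 2 | three => 3 | zero => 4 | bar3 => 5 | bar2 => 6 | bar1 => 7

lemma rank_injective : Function.Injective rank := by
  intro a b; cases a <;> cases b <;> simp [rank]

instance : LinearOrder Letter := LinearOrder.lift' rank rank_injective

/-- The distance on letters: `dist(i,j) = dist(j̄,ī) = j - i` for `i < j`,
`dist(i,0) = dist(0,ī) = 4 - i` and `dist(i,j̄) = 8 - (i + j)` for `i, j = 1, 2, 3`, made symmetric.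
In all cases this is the difference of the positions. -/
def dist (a b : Letter) : ℕ := ((rank a : ℤ) - rank b).natAbs

/-- The coordinates of the weight in the basis `Λ₁, Λ₂`. -/
def wt : Letter → Weight
  | one => ![1, 0] | two => ![-1, 1] | three => ![2, -1] | zero => ![0, 0]
  | bar3 => ![-2, 1] | bar2 => ![1, -1] | bar1 => ![-1, 0]

def ε : Fin 2 → Letter → ℤ
  | 0, two => 1 | 0, zero => 1 | 0, bar3 => 2 | 0, bar1 => 1
  | 1, three => 1 | 1, bar2 => 1
  | _, _ => 0

def φ : Fin 2 → Letter → ℤ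
  | 0, one => 1 | 0, three => 2 | 0, zero => 1 | 0, bar2 => 1
  | 1, two => 1 | 1, bar3 => 1
  | _, _ => 0

def f : Fin 2 → Letter → Option Letter
  | 0, one => some two | 0, three => some zero | 0, zero => some bar3 | 0, bar2 => some bar1
  | 1, two => some three | 1, bar3 => some bar2
  | _, _ => none

def e : Fin 2 → Letter → Option Letter
  | 0, two => some one | 0, zero => some three | 0, bar3 => some zero | 0, bar1 => some bar2
  | 1, three => some two | 1, bar2 => some bar3
  | _, _ => none

end Letter

/-- The crystal `B(Λ₁)` of the `7`-dimensional representation, with crystal graph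
`1 ⟶₁ 2 ⟶₂ 3 ⟶₁ 0 ⟶₁ 3̄ ⟶₂ 2̄ ⟶₁ 1̄`. -/
def B1 : Crystal Letter where
  wt := Letter.wt
  ε := Letter.ε
  φ := Letter.φ
  e := Letter.e
  f := Letter.f
  φ_eq := by decide
  wt_e := by decide
  ε_e := by decide
  φ_e := by decide
  f_iff := by decide

/-- The underlying set of `B(Λ₂)`; the pair `(a, b)` is the column with `a` above `b`. -/
abbrev Column : Type := (B1.tensor B1).Component (Letter.one, Letter.two)

/-- The crystal `B(Λ₂)`: the connected component of the highest weight vector `1 ⊗ 2` of weight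
`Λ₂` in `B(Λ₁) ⊗ B(Λ₁)`. -/
noncomputable def B2 : Crystal Column := (B1.tensor B1).component (Letter.one, Letter.two)

/-! ### The set `S(λ)` of tableaux, `λ = m Λ₁ + n Λ₂` -/

/-- Fillings of the diagram with `n` boxes in the top row and `n + m` boxes in the bottom row, the
rows being right justified. Columns are numbered from right to left, starting with `0`. -/
@[ext] structure Filling (m n : ℕ) where
  top : Fin n → Letter
  bot : Fin (n + m) → Letter

/-- The conditions on the column with `a` above `b`. -/
def ColumnCond (a b : Letter) : Prop :=
  (a < b ∨ (a = .zero ∧ b = .zero)) ∧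
    (if a = .one ∨ a = .zero then a.dist b ≤ 2 else a.dist b ≤ 3)

/-- The condition on two adjacent columns of length `2`, where `a` is the upper left entry and `d` is
the lower right entry. -/
def AdjacentCond (a d : Letter) : Prop :=
  ((a = .two ∨ a = .three ∨ a = .zero) → 3 ≤ a.dist d) ∧ (a = .bar3 → 2 ≤ a.dist d)

/-- The conditions defining `S(λ)`. The entries increase weakly along the rows from left to right,
which is antitonicity here as columns are numbered from right to left. -/
structure Filling.IsTableau {m n : ℕ} (T : Filling m n) : Prop where
  top_antitone : Antitone T.top
  bot_antitone : Antitone T.bot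
  top_zero : ∀ j k, T.top j = .zero → T.top k = .zero → j = k
  bot_zero : ∀ j k, T.bot j = .zero → T.bot k = .zero → j = k
  column : ∀ j : Fin n, ColumnCond (T.top j) (T.bot (Fin.castAdd m j))
  adjacent : ∀ j k : Fin n, (j : ℕ) + 1 = k → AdjacentCond (T.top k) (T.bot (Fin.castAdd m j))

/-- The set `S(m Λ₁ + n Λ₂)`. -/
abbrev Tableau (m n : ℕ) : Type := {T : Filling m n // T.IsTableau}

lemma ColumnCond.connected {a b : Letter} (h : ColumnCond a b) :
    (B1.tensor B1).Connected (.one, .two) (a, b) := by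
  have h1 : (B1.tensor B1).Connected (.one, .two) (.one, .two) := .refl _
  have h2 := h1.of_f (i := 1) (d := (.one, .three)) (by decide)
  have h3 := h2.of_f (i := 0) (d := (.two, .three)) (by decide)
  have h4 := h3.of_f (i := 0) (d := (.two, .zero)) (by decide)
  have h5 := h4.of_f (i := 0) (d := (.two, .bar3)) (by decide)
  have h6 := h4.of_f (i := 1) (d := (.three, .zero)) (by decide)
  have h7 := h5.of_f (i := 1) (d := (.three, .bar3)) (by decide)
  have h8 := h6.of_f (i := 0) (d := (.zero, .zero)) (by decide)
  have h9 := h8.of_f (i := 0) (d := (.zero, .bar3)) (by decide)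
  have h10 := h7.of_f (i := 1) (d := (.three, .bar2)) (by decide)
  have h11 := h10.of_f (i := 0) (d := (.zero, .bar2)) (by decide)
  have h12 := h11.of_f (i := 0) (d := (.bar3, .bar2)) (by decide)
  have h13 := h12.of_f (i := 0) (d := (.bar3, .bar1)) (by decide)
  have h14 := h13.of_f (i := 1) (d := (.bar2, .bar1)) (by decide)
  unfold ColumnCond at h
  cases a <;> cases b <;> first | assumption | exact absurd h (by decide)

/-- The underlying set of `B(Λ₂)^{⊗ n} ⊗ B(Λ₁)^{⊗ m}`. -/
abbrev Words (m n : ℕ) : Type := TPow Column n × TPow Letter m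

/-- The crystal `B(Λ₂)^{⊗ n} ⊗ B(Λ₁)^{⊗ m}`. -/
noncomputable def wordCrystal (m n : ℕ) : Crystal (Words m n) := (B2.power n).tensor (B1.power m)

/-- The tensor product of the columns of a tableau, read from right to left. -/
def Tableau.read {m n : ℕ} (T : Tableau m n) : Words m n :=
  (TPow.ofFn fun j => ⟨(T.1.top j, T.1.bot (Fin.castAdd m j)), (T.2.column j).connected⟩,
    TPow.ofFn fun k => T.1.bot (Fin.natAdd n k))

lemma Tableau.read_injective (m n : ℕ) : Function.Injective (@Tableau.read m n) := by
  intro S T h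
  have h1 := TPow.ofFn_injective (congrArg Prod.fst h)
  have h2 := TPow.ofFn_injective (congrArg Prod.snd h)
  have h3 : ∀ j, (S.1.top j, S.1.bot (Fin.castAdd m j)) = (T.1.top j, T.1.bot (Fin.castAdd m j)) :=
    fun j => congrArg Subtype.val (congrFun h1 j)
  apply Subtype.ext
  apply Filling.ext
  · funext j
    exact congrArg Prod.fst (h3 j)
  · funext k
    exact Fin.addCases (motive := fun k => S.1.bot k = T.1.bot k)
      (fun j => congrArg Prod.snd (h3 j)) (fun j => congrFun h2 j) k

/-- The crystal structure on `S(λ)` induced by its embedding into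
`B(Λ₂)^{⊗ n} ⊗ B(Λ₁)^{⊗ m}`. -/
noncomputable def tableauCrystal (m n : ℕ) : Crystal (Tableau m n) :=
  (wordCrystal m n).pullback Tableau.read (Tableau.read_injective m n)

/-- The vector `(1 ⊗ 2)^{⊗ n} ⊗ 1^{⊗ m}`, the tensor product of the highest weight vectors. The
connected component of this vector is the copy of `B(λ)` in `B(Λ₂)^{⊗ n} ⊗ B(Λ₁)^{⊗ m}`. -/
def highestWord (m n : ℕ) : Words m n :=
  (TPow.ofFn fun _ => ⟨(Letter.one, Letter.two), .refl _⟩, TPow.ofFn fun _ => Letter.one)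

/-! ### The crystal of monomials -/

/-- Laurent monomials in the commuting variables `Y i k`, `i : Fin 2`, `k : ℤ`: the exponents form
a finitely supported function. -/
abbrev Monomial : Type := Multiplicative (Fin 2 × ℤ →₀ ℤ)

/-- The variable `Y i k`. -/
noncomputable def Y (i : Fin 2) (k : ℤ) : Monomial := .ofAdd (Finsupp.single (i, k) 1)

namespace Monomial

/-- The sum of the exponents in `M` of all `Y i k` with `k ∈ s`. -/
noncomputable def exponentSum (i : Fin 2) (s : Set ℤ) (M : Monomial) : ℤ :=
  open Classical in M.toAdd.sum fun p a => if p.1 = i ∧ p.2 ∈ s then a else 0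

noncomputable def wt (M : Monomial) : Weight := fun i => exponentSum i Set.univ M

/-- `φ i M` is the maximum over `k` of the sum of the exponents of `Y i l` with `l ≤ k`. -/
noncomputable def φ (i : Fin 2) (M : Monomial) : ℤ := ⨆ k : ℤ, exponentSum i (Set.Iic k) M

/-- `ε i M` is the maximum over `k` of minus the sum of the exponents of `Y i l` with `l > k`. -/
noncomputable def ε (i : Fin 2) (M : Monomial) : ℤ := ⨆ k : ℤ, -exponentSum i (Set.Ioi k) M

/-- The smallest `k` at which the maximum `φ i M` is attained. -/
noncomputable def nf (i : Fin 2) (M : Monomial) : ℤ :=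
  sInf {k : ℤ | exponentSum i (Set.Iic k) M = φ i M}

/-- The largest `k` at which the maximum `φ i M` is attained. -/
noncomputable def ne (i : Fin 2) (M : Monomial) : ℤ :=
  sSup {k : ℤ | exponentSum i (Set.Iic k) M = φ i M}

/-- The monomials `A₁(k) = Y₁(k) Y₁(k+1) Y₂(k)⁻¹` and `A₂(k) = Y₂(k) Y₂(k+1) Y₁(k+1)⁻³`. -/
noncomputable def A : Fin 2 → ℤ → Monomial
  | 0, k => Y 0 k * Y 0 (k + 1) * (Y 1 k)⁻¹
  | 1, k => Y 1 k * Y 1 (k + 1) * (Y 0 (k + 1) ^ 3)⁻¹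

noncomputable def f (i : Fin 2) (M : Monomial) : Option Monomial :=
  if φ i M = 0 then none else some ((A i (nf i M))⁻¹ * M)

noncomputable def e (i : Fin 2) (M : Monomial) : Option Monomial :=
  if ε i M = 0 then none else some (A i (ne i M) * M)

/-! #### The crystal axioms -/

lemma exponentSum_mul (i : Fin 2) (s : Set ℤ) (M N : Monomial) :
    exponentSum i s (M * N) = exponentSum i s M + exponentSum i s N := by
  classical
  unfold exponentSum
  rw [toAdd_mul]
  apply Finsupp.sum_add_index'
  · simp
  · intro p a b
    split_ifs <;> simp

lemma exponentSum_one (i : Fin 2) (s : Set ℤ) : exponentSum i s 1 = 0 := by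
  have h := exponentSum_mul i s 1 1
  rw [mul_one] at h
  omega

lemma exponentSum_inv (i : Fin 2) (s : Set ℤ) (M : Monomial) :
    exponentSum i s M⁻¹ = -exponentSum i s M := by
  have h := exponentSum_mul i s M⁻¹ M
  rw [inv_mul_cancel, exponentSum_one] at h
  omega

lemma exponentSum_ofAdd_single (i j : Fin 2) (s : Set ℤ) (k a : ℤ) [Decidable (j = i ∧ k ∈ s)] :
    exponentSum i s (.ofAdd (Finsupp.single (j, k) a)) = if j = i ∧ k ∈ s then a else 0 := by
  classical
  unfold exponentSum
  rw [toAdd_ofAdd, Finsupp.sum_single_index (by simp)]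
  congr

lemma exponentSum_Y (i j : Fin 2) (s : Set ℤ) (k : ℤ) [Decidable (j = i ∧ k ∈ s)] :
    exponentSum i s (Y j k) = if j = i ∧ k ∈ s then 1 else 0 :=
  exponentSum_ofAdd_single i j s k 1

lemma exponentSum_Iic_add_Ioi (i : Fin 2) (k : ℤ) (M : Monomial) :
    exponentSum i (Set.Iic k) M + exponentSum i (Set.Ioi k) M = wt M i := by
  classical
  unfold wt exponentSum
  rw [← Finsupp.sum_add]
  apply Finsupp.sum_congr
  intro p _
  by_cases h1 : p.1 = i <;> by_cases h2 : p.2 ≤ k <;> simp [h1, h2, not_lt.2]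

lemma exists_stable (i : Fin 2) (M : Monomial) : ∃ N : ℤ, ∀ k,
    (k ≤ -N → exponentSum i (Set.Iic k) M = 0) ∧
      (N ≤ k → exponentSum i (Set.Iic k) M = wt M i) := by
  classical
  induction M using Multiplicative.rec with
  | ofAdd x =>
  induction x using Finsupp.induction_linear with
  | zero =>
    refine ⟨0, fun k => ?_⟩
    simp [wt, exponentSum_one]
  | add x y hx hy =>
    obtain ⟨N₁, h₁⟩ := hx
    obtain ⟨N₂, h₂⟩ := hy
    refine ⟨max N₁ N₂, fun k => ?_⟩
    have h3 := h₁ k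
    have h4 := h₂ k
    simp only [wt, ofAdd_add, exponentSum_mul] at *
    refine ⟨fun h => ?_, fun h => ?_⟩
    · rw [h3.1 (by omega), h4.1 (by omega)]; rfl
    · rw [h3.2 (by omega), h4.2 (by omega)]
  | single p a =>
    obtain ⟨j, l⟩ := p
    refine ⟨|l| + 1, fun k => ?_⟩
    simp only [wt, exponentSum_ofAdd_single, Set.mem_Iic, Set.mem_univ, and_true]
    have := abs_le.1 (le_refl |l|)
    refine ⟨fun h => ?_, fun h => ?_⟩
    · rw [if_neg (by omega)]
    · have h' : l ≤ k := by omega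
      simp only [h', and_true]

lemma finite_range (i : Fin 2) (M : Monomial) :
    (Set.range fun k : ℤ => exponentSum i (Set.Iic k) M).Finite := by
  obtain ⟨N, hN⟩ := exists_stable i M
  refine ((((Set.finite_Icc (-N) N).image fun k : ℤ => exponentSum i (Set.Iic k) M).insert
    (wt M i)).insert 0).subset ?_
  rintro _ ⟨k, rfl⟩
  by_cases h1 : k ≤ -N
  · exact .inl ((hN k).1 h1)
  by_cases h2 : N ≤ k
  · exact .inr (.inl ((hN k).2 h2))
  · exact .inr (.inr ⟨k, ⟨by omega, by omega⟩, rfl⟩)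

lemma le_φ (i : Fin 2) (M : Monomial) (k : ℤ) : exponentSum i (Set.Iic k) M ≤ φ i M :=
  le_ciSup (finite_range i M).bddAbove k

lemma exists_eq_φ (i : Fin 2) (M : Monomial) : ∃ k : ℤ, exponentSum i (Set.Iic k) M = φ i M :=
  (Set.range_nonempty _).csSup_mem (finite_range i M)

lemma φ_eq_of {i : Fin 2} {M : Monomial} {c k : ℤ} (h : ∀ l, exponentSum i (Set.Iic l) M ≤ c)
    (hk : exponentSum i (Set.Iic k) M = c) : φ i M = c :=
  le_antisymm (ciSup_le h) (hk ▸ le_φ i M k)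

lemma φ_nonneg (i : Fin 2) (M : Monomial) : 0 ≤ φ i M := by
  obtain ⟨N, hN⟩ := exists_stable i M
  exact (hN (-N)).1 le_rfl ▸ le_φ i M (-N)

lemma φ_eq (i : Fin 2) (M : Monomial) : φ i M = ε i M + wt M i := by
  have h : ε i M = φ i M - wt M i := by
    have h1 : ∀ k, -exponentSum i (Set.Ioi k) M = exponentSum i (Set.Iic k) M - wt M i := by
      intro k
      have := exponentSum_Iic_add_Ioi i k M
      omega
    unfold ε
    simp only [h1]
    obtain ⟨k, hk⟩ := exists_eq_φ i M
    apply le_antisymm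
    · exact ciSup_le fun l => by have := le_φ i M l; omega
    · rw [← hk]
      refine le_ciSup (f := fun k : ℤ => exponentSum i (Set.Iic k) M - wt M i)
        ⟨φ i M - wt M i, ?_⟩ k
      rintro _ ⟨l, rfl⟩
      have := le_φ i M l
      simp only
      omega
  omega

lemma ε_nonneg (i : Fin 2) (M : Monomial) : 0 ≤ ε i M := by
  obtain ⟨N, hN⟩ := exists_stable i M
  have h1 := (hN N).2 le_rfl
  have h2 := le_φ i M N
  have h3 := φ_eq i M
  omega

lemma nf_eq_of {i : Fin 2} {M : Monomial} {k : ℤ} (hk : exponentSum i (Set.Iic k) M = φ i M)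
    (h : ∀ l < k, exponentSum i (Set.Iic l) M ≠ φ i M) : nf i M = k := by
  apply IsLeast.csInf_eq
  exact ⟨hk, fun l hl => not_lt.1 fun hlk => h l hlk hl⟩

lemma ne_eq_of {i : Fin 2} {M : Monomial} {k : ℤ} (hk : exponentSum i (Set.Iic k) M = φ i M)
    (h : ∀ l, k < l → exponentSum i (Set.Iic l) M ≠ φ i M) : ne i M = k := by
  apply IsGreatest.csSup_eq
  exact ⟨hk, fun l hl => not_lt.1 fun hlk => h l hlk hl⟩

lemma nf_spec {i : Fin 2} {M : Monomial} (h : φ i M ≠ 0) :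
    exponentSum i (Set.Iic (nf i M)) M = φ i M ∧
      ∀ l < nf i M, exponentSum i (Set.Iic l) M ≠ φ i M := by
  obtain ⟨N, hN⟩ := exists_stable i M
  have hb : BddBelow {k : ℤ | exponentSum i (Set.Iic k) M = φ i M} := by
    refine ⟨-N, fun k hk => ?_⟩
    by_contra hlt
    have h0 := (hN k).1 (by omega)
    have hk' : exponentSum i (Set.Iic k) M = φ i M := hk
    omega
  refine ⟨Int.csInf_mem (exists_eq_φ i M) hb, fun l hl hl' => ?_⟩
  have := csInf_le hb hl'
  unfold nf at hl
  omega

lemma ne_spec {i : Fin 2} {M : Monomial} (h : ε i M ≠ 0) :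
    exponentSum i (Set.Iic (ne i M)) M = φ i M ∧
      ∀ l, ne i M < l → exponentSum i (Set.Iic l) M ≠ φ i M := by
  obtain ⟨N, hN⟩ := exists_stable i M
  have hφ := φ_eq i M
  have hb : BddAbove {k : ℤ | exponentSum i (Set.Iic k) M = φ i M} := by
    refine ⟨N, fun k hk => ?_⟩
    by_contra hlt
    have h0 := (hN k).2 (by omega)
    have hk' : exponentSum i (Set.Iic k) M = φ i M := hk
    omega
  refine ⟨Int.csSup_mem (exists_eq_φ i M) hb, fun l hl hl' => ?_⟩
  have := le_csSup hb hl'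
  unfold ne at hl
  omega

lemma exponentSum_A (i : Fin 2) (k l : ℤ) :
    exponentSum i (Set.Iic l) (A i k) = (if k ≤ l then 1 else 0) + (if k + 1 ≤ l then 1 else 0) := by
  classical
  fin_cases i <;>
    simp [A, exponentSum_mul, exponentSum_inv, exponentSum_Y, pow_succ]

lemma wt_mul (M N : Monomial) : wt (M * N) = wt M + wt N :=
  funext fun i => exponentSum_mul i _ M N

lemma wt_inv (M : Monomial) : wt M⁻¹ = -wt M :=
  funext fun i => exponentSum_inv i _ M

lemma wt_A (i : Fin 2) (k : ℤ) : wt (A i k) = root i := by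
  classical
  funext j
  fin_cases i <;> fin_cases j <;>
    simp [wt, A, exponentSum_mul, exponentSum_inv, exponentSum_Y, root, cartan, pow_succ]

lemma e_data {i : Fin 2} {M : Monomial} (h : ε i M ≠ 0) :
    φ i (A i (ne i M) * M) = φ i M + 1 ∧ nf i (A i (ne i M) * M) = ne i M := by
  obtain ⟨h1, h2⟩ := ne_spec h
  set k := ne i M
  have key : ∀ l, exponentSum i (Set.Iic l) (A i k * M) =
      (if k ≤ l then 1 else 0) + (if k + 1 ≤ l then 1 else 0) + exponentSum i (Set.Iic l) M :=
    fun l => by rw [exponentSum_mul, exponentSum_A]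
  have hφ : φ i (A i k * M) = φ i M + 1 := by
    refine φ_eq_of (k := k) (fun l => ?_) ?_
    · have h3 := le_φ i M l
      have h4 := h2 l
      rw [key]
      split_ifs <;> omega
    · rw [key, h1]
      split_ifs <;> omega
  refine ⟨hφ, nf_eq_of ?_ fun l hl => ?_⟩
  · rw [key, h1, hφ]
    split_ifs <;> omega
  · have h3 := le_φ i M l
    rw [key, hφ]
    split_ifs <;> omega

lemma f_data {i : Fin 2} {M : Monomial} (h : φ i M ≠ 0) :
    φ i ((A i (nf i M))⁻¹ * M) = φ i M - 1 ∧ ne i ((A i (nf i M))⁻¹ * M) = nf i M := by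
  obtain ⟨h1, h2⟩ := nf_spec h
  set k := nf i M
  have key : ∀ l, exponentSum i (Set.Iic l) ((A i k)⁻¹ * M) =
      -((if k ≤ l then 1 else 0) + (if k + 1 ≤ l then 1 else 0)) + exponentSum i (Set.Iic l) M :=
    fun l => by rw [exponentSum_mul, exponentSum_inv, exponentSum_A]
  have hφ : φ i ((A i k)⁻¹ * M) = φ i M - 1 := by
    refine φ_eq_of (k := k) (fun l => ?_) ?_
    · have h3 := le_φ i M l
      have h4 := h2 l
      rw [key]
      split_ifs <;> omega
    · rw [key, h1]
      split_ifs <;> omega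
  refine ⟨hφ, ne_eq_of ?_ fun l hl => ?_⟩
  · rw [key, h1, hφ]
    split_ifs <;> omega
  · have h3 := le_φ i M l
    rw [key, hφ]
    split_ifs <;> omega

lemma e_spec {i : Fin 2} {M N : Monomial} (h : e i M = some N) :
    ε i M ≠ 0 ∧ N = A i (ne i M) * M := by
  unfold e at h
  split_ifs at h with h'
  exact ⟨h', (Option.some.inj h).symm⟩

lemma f_spec {i : Fin 2} {M N : Monomial} (h : f i M = some N) :
    φ i M ≠ 0 ∧ N = (A i (nf i M))⁻¹ * M := by
  unfold f at h
  split_ifs at h with h'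
  exact ⟨h', (Option.some.inj h).symm⟩

/-- The crystal of all monomials. -/
noncomputable def crystal : Crystal Monomial where
  wt := wt
  ε := ε
  φ := φ
  e := e
  f := f
  φ_eq := φ_eq
  wt_e i M N h := by
    obtain ⟨_, rfl⟩ := e_spec h
    rw [wt_mul, wt_A, add_comm]
  ε_e i M N h := by
    obtain ⟨h', rfl⟩ := e_spec h
    have h1 := (e_data h').1
    have h2 := φ_eq i M
    have h3 := φ_eq i (A i (ne i M) * M)
    rw [wt_mul, wt_A, Pi.add_apply, root_self] at h3
    omega
  φ_e i M N h := by
    obtain ⟨h', rfl⟩ := e_spec h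
    exact (e_data h').1
  f_iff i M N := by
    constructor
    · intro h
      obtain ⟨h', rfl⟩ := f_spec h
      obtain ⟨h1, h2⟩ := f_data h'
      have h3 := φ_eq i M
      have h4 := φ_eq i ((A i (nf i M))⁻¹ * M)
      rw [wt_mul, wt_inv, wt_A, Pi.add_apply, Pi.neg_apply, root_self] at h4
      have h5 := ε_nonneg i M
      unfold e
      rw [if_neg (by omega), h2, mul_inv_cancel_left]
    · intro h
      obtain ⟨h', rfl⟩ := e_spec h
      obtain ⟨h1, h2⟩ := e_data h'
      have h3 := φ_nonneg i N
      unfold f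
      rw [if_neg (by omega), h2, inv_mul_cancel_left]

/-- The monomials `X a k` for a letter `a`. -/
noncomputable def X : Letter → ℤ → Monomial
  | .one, k => Y 0 k
  | .two, k => (Y 0 (k + 1))⁻¹ * Y 1 k
  | .three, k => Y 0 (k + 1) ^ 2 * (Y 1 (k + 1))⁻¹
  | .zero, k => Y 0 (k + 1) * (Y 0 (k + 2))⁻¹
  | .bar3, k => (Y 0 (k + 2) ^ 2)⁻¹ * Y 1 (k + 1)
  | .bar2, k => Y 0 (k + 2) * (Y 1 (k + 2))⁻¹
  | .bar1, k => (Y 0 (k + 3))⁻¹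

/-- The highest weight monomial `Y₁(1)^m Y₂(1)^n`. -/
noncomputable def highest (m n : ℕ) : Monomial := Y 0 1 ^ m * Y 1 1 ^ n

/-- The set `M(m Λ₁ + n Λ₂)`: the connected component of `Y₁(1)^m Y₂(1)^n`. -/
abbrev Comp (m n : ℕ) : Type := crystal.Component (highest m n)

/-- The crystal `M(m Λ₁ + n Λ₂)`. -/
noncomputable def compCrystal (m n : ℕ) : Crystal (Comp m n) := crystal.component (highest m n)

end Monomial

/-- The monomial `X_{a_1}(2) ⋯ X_{a_n}(2) X_{b_1}(1) ⋯ X_{b_{n+m}}(1)` of the filling with top row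
`a_n, …, a_1` and bottom row `b_{n+m}, …, b_1` (from left to right). -/
noncomputable def Filling.monomial {m n : ℕ} (T : Filling m n) : Monomial :=
  (∏ j, Monomial.X (T.top j) 2) * ∏ k, Monomial.X (T.bot k) 1

end G2

namespace G2

/-! ### Cells -/

/-! A tableau is read from right to left as a list of cells, and columns of both heights live in the
single finite crystal `cellCrystal`. Being a tableau amounts to the relation `Rel` between
neighbouring cells. By finite checks, `Rel` is transitive and survives a Kashiwara operator on the
tensor product of two cells. An operator on a word changes one factor, and its choice agrees with
the rule for that factor and its neighbour, so good words are closed under all operators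
(`isChain_listE`, `isChain_listF`).

On the monomial side, give a variable Y_i(k) the position 2k+1 if its exponent is positive and 2k if
it is negative. If all positions in M are at least all positions in N, the partial sums of the
exponents of MN run through those of N and continue with those of M, so f_i on MN follows
Kashiwara's rule for M ⊗ N (`φ_mul`, `f_mul`). The tableau conditions put the entries in this order:
`letterHi_le_topLo` inside a column, `hi_le_lo` between columns. Hence taking monomials commutes
with f_i on good words, and with e_i because e_i inverts f_i.

A good word killed by all e_i is the highest word (`IsGood.eq_highestWord`), and every e_i lowers
the sum of the ranks of the letters. So the good words are exactly the component of the highest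
word. Induction on the rank shows that a good word is determined by its monomial, and closure under
the operators shows that the monomials of good words fill M(λ). The isomorphism ψ is the inverse of
taking the monomial of a tableau. -/

instance (a b : Letter) : Decidable (ColumnCond a b) := by unfold ColumnCond; infer_instance

instance (a d : Letter) : Decidable (AdjacentCond a d) := by unfold AdjacentCond; infer_instance

/-- The crystal `B(Λ₁)` with an additional component `{none}` of weight `0`. -/
def optB1 : Crystal (Option Letter) where
  wt a := a.elim 0 Letter.wt
  ε i a := a.elim 0 (Letter.ε i)
  φ i a := a.elim 0 (Letter.φ i)
  e i a := a.elim none fun a => (Letter.e i a).map some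
  f i a := a.elim none fun a => (Letter.f i a).map some
  φ_eq := by decide
  wt_e := by decide
  ε_e := by decide
  φ_e := by decide
  f_iff := by decide

/-- A cell `(a, b)` is a column of height two with `a` above `b`, or of height one with entry `b`
if `a = none`. -/
abbrev Cell : Type := Option Letter × Letter

/-- The crystal of cells, containing both `B(Λ₁)` and `B(Λ₂)`. -/
def cellCrystal : Crystal Cell := optB1.tensor B1

namespace Cell

/-- The condition for a cell to occur in a tableau. -/
def Valid : Cell → Prop
  | (none, _) => True
  | (some a, b) => ColumnCond a b

instance : DecidablePred Valid
  | (none, _) => inferInstanceAs (Decidable True)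
  | (some a, b) => inferInstanceAs (Decidable (ColumnCond a b))

/-- `x` may stand to the right of `y` in a row. -/
def RowCond (x y : Letter) : Prop := y ≤ x ∧ ¬ (x = .zero ∧ y = .zero)

instance (x y : Letter) : Decidable (RowCond x y) := by unfold RowCond; infer_instance

/-- The condition for `c` to stand to the right of `d`, apart from the validity of both. -/
def Fits : Cell → Cell → Prop
  | (_, b), (none, b') => RowCond b b'
  | (none, _), (some _, _) => False
  | (some a, b), (some a', b') => RowCond a a' ∧ RowCond b b' ∧ AdjacentCond a' b

instance : DecidableRel Fits
  | (none, b), (none, b') => inferInstanceAs (Decidable (RowCond b b'))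
  | (some _, b), (none, b') => inferInstanceAs (Decidable (RowCond b b'))
  | (none, _), (some _, _) => inferInstanceAs (Decidable False)
  | (some a, b), (some a', b') =>
    inferInstanceAs (Decidable (RowCond a a' ∧ RowCond b b' ∧ AdjacentCond a' b))

/-- The condition for `c` and `d` to be adjacent cells of a tableau, `c` being on the right. -/
def Rel (c d : Cell) : Prop := c.Valid ∧ d.Valid ∧ c.Fits d

instance : DecidableRel Rel := fun c d =>
  inferInstanceAs (Decidable (c.Valid ∧ d.Valid ∧ c.Fits d))

lemma valid_f : ∀ i c, Valid c → ∀ d ∈ cellCrystal.f i c, Valid d := by decide +kernel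

lemma valid_e : ∀ i c, Valid c → ∀ d ∈ cellCrystal.e i c, Valid d := by decide +kernel

/-- The inequality says that the tensor rule lets the operator act on this factor. Without it the
relation may be destroyed. This and the three following checks are the combinatorial core of closure
under the operators. -/
lemma rel_f_left : ∀ i c d, Rel c d → cellCrystal.ε i d < cellCrystal.φ i c →
    ∀ x ∈ cellCrystal.f i c, Rel x d := by decide +kernel

lemma rel_f_right : ∀ i c d, Rel c d → cellCrystal.φ i c ≤ cellCrystal.ε i d →
    ∀ x ∈ cellCrystal.f i d, Rel c x := by decide +kernel

lemma rel_e_left : ∀ i c d, Rel c d → cellCrystal.ε i d ≤ cellCrystal.φ i c →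
    ∀ x ∈ cellCrystal.e i c, Rel x d := by decide +kernel

lemma rel_e_right : ∀ i c d, Rel c d → cellCrystal.φ i c < cellCrystal.ε i d →
    ∀ x ∈ cellCrystal.e i d, Rel c x := by decide +kernel

/-- Conditions on neighbours thereby become conditions on all pairs, as needed to compare the
monomial of a cell with the product of all cells to its left. -/
lemma fits_trans : ∀ c d, Rel c d → ∀ x, Rel d x → Fits c x := by decide +kernel

instance : IsTrans Cell Rel := ⟨fun _ _ _ h h' => ⟨h.1, h'.2.1, fits_trans _ _ h _ h'⟩⟩

lemma ε_nonneg : ∀ i c, 0 ≤ cellCrystal.ε i c := by decide +kernel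

lemma φ_nonneg : ∀ i c, 0 ≤ cellCrystal.φ i c := by decide +kernel

lemma ε_eq_zero_of_e : ∀ i c, cellCrystal.e i c = none → cellCrystal.ε i c = 0 := by decide +kernel

lemma highest : ∀ c, Valid c → (∀ i, cellCrystal.ε i c = 0) →
    c = (some .one, .two) ∨ c = (none, .one) := by decide +kernel

/-- The single letter 2 is the only neighbour here that is not of highest weight; it is excluded
later by ε of the whole word. -/
lemma rel_column_one_two : ∀ c, Rel (some .one, .two) c →
    c = (some .one, .two) ∨ c = (none, .one) ∨ c = (none, .two) := by decide +kernel

lemma rel_one : ∀ c, Rel (none, .one) c → c = (none, .one) := by decide +kernel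

/-- The sum of the positions of the entries. -/
def rank (c : Cell) : ℕ := c.1.elim 0 Letter.rank + c.2.rank

/-- This makes the rank a termination measure for moving up to the highest word. -/
lemma rank_e : ∀ i c, ∀ d ∈ cellCrystal.e i c, rank d + 1 = rank c := by decide +kernel

end Cell

/-! ### Words as lists -/

namespace Crystal

variable {A B : Type*}

/-- The weight of the tensor product of the elements of a list. -/
def listWt (C : Crystal B) : List B → Weight
  | [] => 0
  | b :: l => C.wt b + C.listWt l

/-- The value of `ε` on the tensor product of the elements of a list. -/
def listε (C : Crystal B) (i : Fin 2) : List B → ℤ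
  | [] => 0
  | b :: l => max (C.ε i b) (C.listε i l - C.wt b i)

/-- The value of `φ` on the tensor product of the elements of a list. -/
def listφ (C : Crystal B) (i : Fin 2) : List B → ℤ
  | [] => 0
  | b :: l => max (C.listφ i l) (C.φ i b + C.listWt l i)

/-- The action of `e i` on the tensor product of the elements of a list. -/
def listE (C : Crystal B) (i : Fin 2) : List B → Option (List B)
  | [] => none
  | b :: l => if C.listε i l ≤ C.φ i b then (C.e i b).map (· :: l) else (C.listE i l).map (b :: ·)

/-- The action of `f i` on the tensor product of the elements of a list. -/
def listF (C : Crystal B) (i : Fin 2) : List B → Option (List B)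
  | [] => none
  | b :: l => if C.listε i l < C.φ i b then (C.f i b).map (· :: l) else (C.listF i l).map (b :: ·)

lemma listφ_eq (C : Crystal B) (i : Fin 2) :
    ∀ l, C.listφ i l = C.listε i l + C.listWt l i
  | [] => rfl
  | b :: l => by
    have h := C.listφ_eq i l
    have h' := C.φ_eq i b
    simp only [listφ, listε, listWt, Pi.add_apply]
    omega

lemma listWt_append (C : Crystal B) : ∀ l l', C.listWt (l ++ l') = C.listWt l + C.listWt l'
  | [], l' => by simp [listWt]
  | b :: l, l' => by simp [listWt, C.listWt_append l l', add_assoc]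

/-- The functions `ε` and `φ` are nonnegative, and `e i b` vanishes only if `ε i b` does. -/
structure IsSeminormal (C : Crystal B) : Prop where
  ε_nonneg : ∀ i b, 0 ≤ C.ε i b
  φ_nonneg : ∀ i b, 0 ≤ C.φ i b
  ε_eq_zero : ∀ i b, C.e i b = none → C.ε i b = 0

namespace IsSeminormal

variable {C : Crystal B} (hC : C.IsSeminormal)
include hC

lemma e_eq_none {i : Fin 2} {b : B} (h : C.ε i b ≤ 0) : C.e i b = none := by
  rcases he : C.e i b with _ | c
  · rfl
  · have h1 := C.ε_e _ _ _ he
    have h2 := hC.ε_nonneg i c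
    omega

lemma listε_nonneg (i : Fin 2) : ∀ l, 0 ≤ C.listε i l
  | [] => le_rfl
  | b :: _ => (hC.ε_nonneg i b).trans (le_max_left _ _)

lemma listE_eq_none (i : Fin 2) : ∀ l, C.listε i l = 0 → C.listE i l = none
  | [], _ => rfl
  | b :: l, h => by
    have h1 := hC.listε_nonneg i l
    have h2 := hC.ε_nonneg i b
    have h3 := C.φ_eq i b
    simp only [listε] at h
    simp only [listE]
    split_ifs with h'
    · rw [hC.e_eq_none (by omega)]; rfl
    · rw [listE_eq_none i l (by omega)]; rfl

/-- If e_i acts on b, then `listε l - wt b ≤ φ b - wt b = ε b = 0`. If it acts on l, induction gives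
`listε l = 0`, against `φ b < listε l`. -/
lemma listε_eq_zero (i : Fin 2) : ∀ l, C.listE i l = none → C.listε i l = 0
  | [], _ => rfl
  | b :: l, h => by
    have h2 := hC.φ_nonneg i b
    have h3 := C.φ_eq i b
    simp only [listE] at h
    simp only [listε]
    split_ifs at h with h'
    · have := hC.ε_eq_zero i b (Option.map_eq_none_iff.1 h)
      omega
    · have := listε_eq_zero i l (Option.map_eq_none_iff.1 h)
      omega

lemma listε_append (i : Fin 2) :
    ∀ l l', C.listε i (l ++ l') = max (C.listε i l) (C.listε i l' - C.listWt l i)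
  | [], l' => by simp [listε, listWt, hC.listε_nonneg i l']
  | b :: l, l' => by
    simp only [List.cons_append, listε, listWt, Pi.add_apply, listε_append i l l']
    omega

/-- Associativity of the tensor rule. The empty left block has φ = 0, so a right block with ε = 0 is
not the one acted on; seminormality makes the two sides agree there, both being `none`. -/
lemma listE_append (i : Fin 2) :
    ∀ l l', C.listE i (l ++ l') = if C.listε i l' ≤ C.listφ i l then (C.listE i l).map (· ++ l')
        else (C.listE i l').map (l ++ ·)
  | [], l' => by
    have h := hC.listε_nonneg i l'
    rcases h.eq_or_lt with h' | h'
    · rw [if_pos (show C.listε i l' ≤ C.listφ i [] from h'.ge), List.nil_append, hC.listE_eq_none i l' h'.symm]; rfl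
    · rw [if_neg (by simp only [listφ]; omega)]; simp
  | b :: l, l' => by
    have h1 := C.listφ_eq i l
    rw [List.cons_append, listE, listE_append i l l', listE, listφ, hC.listε_append i l l']
    by_cases h2 : max (C.listε i l) (C.listε i l' - C.listWt l i) ≤ C.φ i b
    · rw [if_pos h2, if_pos (by omega), if_pos (by omega), Option.map_map]; rfl
    · rw [if_neg h2]
      by_cases h3 : C.listε i l' ≤ C.listφ i l
      · rw [if_pos h3, if_pos (by omega), if_neg (by omega), Option.map_map, Option.map_map]; rfl
      · rw [if_neg h3, if_neg (by omega), Option.map_map]; rfl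

lemma listF_append (i : Fin 2) :
    ∀ l l', C.listF i (l ++ l') = if C.listε i l' < C.listφ i l then (C.listF i l).map (· ++ l')
        else (C.listF i l').map (l ++ ·)
  | [], l' => by
    have h := hC.listε_nonneg i l'
    rw [if_neg (by simp only [listφ]; omega)]; simp
  | b :: l, l' => by
    have h1 := C.listφ_eq i l
    rw [List.cons_append, listF, listF_append i l l', listF, listφ, hC.listε_append i l l']
    by_cases h2 : max (C.listε i l) (C.listε i l' - C.listWt l i) < C.φ i b
    · rw [if_pos h2, if_pos (by omega), if_pos (by omega), Option.map_map]; rfl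
    · rw [if_neg h2]
      by_cases h3 : C.listε i l' < C.listφ i l
      · rw [if_pos h3, if_pos (by omega), if_neg (by omega), Option.map_map, Option.map_map]; rfl
      · rw [if_neg h3, if_neg (by omega), Option.map_map]; rfl

end IsSeminormal

/-- A relation between neighbours that is stable under the Kashiwara operators on tensor products
of two elements. -/
structure IsStable (C : Crystal B) (R : B → B → Prop) : Prop where
  e_left : ∀ i b c, R b c → C.ε i c ≤ C.φ i b → ∀ x ∈ C.e i b, R x c
  e_right : ∀ i b c, R b c → C.φ i b < C.ε i c → ∀ x ∈ C.e i c, R b x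
  f_left : ∀ i b c, R b c → C.ε i c < C.φ i b → ∀ x ∈ C.f i b, R x c
  f_right : ∀ i b c, R b c → C.φ i b ≤ C.ε i c → ∀ x ∈ C.f i c, R b x

namespace IsStable

variable {C : Crystal B} {R : B → B → Prop} (hR : C.IsStable R)
include hR

/-- Only the pairs containing the changed factor matter. If b changes, `ε c ≤ ε (c :: l) ≤ φ b`. If
c changes, `ε l ≤ φ c` gives `ε l - wt c ≤ ε c`, so `ε (c :: l) = ε c > φ b`. Both are the
hypotheses of stability for two factors. -/
lemma isChain_listE (i : Fin 2) :
    ∀ l, l.IsChain R → ∀ l' ∈ C.listE i l, l'.IsChain R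
  | [], _, l', h' => by simp [listE] at h'
  | [b], _, l', h' => by
    simp only [listE, Option.map_none] at h'
    split_ifs at h' <;> simp at h'
    obtain ⟨x, -, rfl⟩ := h'
    simp
  | b :: c :: l, h, l', h' => by
    have IH := isChain_listE i (c :: l)
    have h3 := C.φ_eq i c
    have h4 : C.listε i (c :: l) = max (C.ε i c) (C.listε i l - C.wt c i) := rfl
    rw [List.isChain_cons_cons] at h
    rw [listE, Option.mem_def] at h'
    by_cases h1 : C.listε i (c :: l) ≤ C.φ i b
    · rw [if_pos h1, Option.map_eq_some_iff] at h'
      obtain ⟨x, hx, rfl⟩ := h'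
      exact List.isChain_cons_cons.2 ⟨hR.e_left i b c h.1 (by omega) x hx, h.2⟩
    · rw [if_neg h1, Option.map_eq_some_iff] at h'
      obtain ⟨y, hy, rfl⟩ := h'
      have hy' := IH h.2 y hy
      rw [listE] at hy
      by_cases h2 : C.listε i l ≤ C.φ i c
      · rw [if_pos h2, Option.map_eq_some_iff] at hy
        obtain ⟨x, hx, rfl⟩ := hy
        exact List.isChain_cons_cons.2 ⟨hR.e_right i b c h.1 (by omega) x hx, hy'⟩
      · rw [if_neg h2, Option.map_eq_some_iff] at hy
        obtain ⟨x, hx, rfl⟩ := hy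
        exact List.isChain_cons_cons.2 ⟨h.1, hy'⟩

lemma isChain_listF (i : Fin 2) :
    ∀ l, l.IsChain R → ∀ l' ∈ C.listF i l, l'.IsChain R
  | [], _, l', h' => by simp [listF] at h'
  | [b], _, l', h' => by
    simp only [listF, Option.map_none] at h'
    split_ifs at h' <;> simp at h'
    obtain ⟨x, -, rfl⟩ := h'
    simp
  | b :: c :: l, h, l', h' => by
    have IH := isChain_listF i (c :: l)
    have h3 := C.φ_eq i c
    have h4 : C.listε i (c :: l) = max (C.ε i c) (C.listε i l - C.wt c i) := rfl
    rw [List.isChain_cons_cons] at h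
    rw [listF, Option.mem_def] at h'
    by_cases h1 : C.listε i (c :: l) < C.φ i b
    · rw [if_pos h1, Option.map_eq_some_iff] at h'
      obtain ⟨x, hx, rfl⟩ := h'
      exact List.isChain_cons_cons.2 ⟨hR.f_left i b c h.1 (by omega) x hx, h.2⟩
    · rw [if_neg h1, Option.map_eq_some_iff] at h'
      obtain ⟨y, hy, rfl⟩ := h'
      have hy' := IH h.2 y hy
      rw [listF] at hy
      by_cases h2 : C.listε i l < C.φ i c
      · rw [if_pos h2, Option.map_eq_some_iff] at hy
        obtain ⟨x, hx, rfl⟩ := hy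
        exact List.isChain_cons_cons.2 ⟨hR.f_right i b c h.1 (by omega) x hx, hy'⟩
      · rw [if_neg h2, Option.map_eq_some_iff] at hy
        obtain ⟨x, hx, rfl⟩ := hy
        exact List.isChain_cons_cons.2 ⟨h.1, hy'⟩

end IsStable

/-- A property of elements that is stable under `e i` passes to the lists. -/
lemma forall_listE (C : Crystal B) (i : Fin 2) {p : B → Prop}
    (hp : ∀ b, p b → ∀ x ∈ C.e i b, p x) :
    ∀ l : List B, (∀ b ∈ l, p b) → ∀ l' ∈ C.listE i l, ∀ b ∈ l', p b
  | [], _, l', h' => by simp [listE] at h'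
  | b :: l, h, l', h' => by
    rw [List.forall_mem_cons] at h
    simp only [listE, Option.mem_def] at h'
    split_ifs at h' <;> rw [Option.map_eq_some_iff] at h'
    · obtain ⟨x, hx, rfl⟩ := h'
      exact List.forall_mem_cons.2 ⟨hp b h.1 x hx, h.2⟩
    · obtain ⟨x, hx, rfl⟩ := h'
      exact List.forall_mem_cons.2 ⟨h.1, forall_listE C i hp l h.2 x hx⟩

/-- A property of elements that is stable under `f i` passes to the lists. -/
lemma forall_listF (C : Crystal B) (i : Fin 2) {p : B → Prop}
    (hp : ∀ b, p b → ∀ x ∈ C.f i b, p x) :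
    ∀ l : List B, (∀ b ∈ l, p b) → ∀ l' ∈ C.listF i l, ∀ b ∈ l', p b
  | [], _, l', h' => by simp [listF] at h'
  | b :: l, h, l', h' => by
    rw [List.forall_mem_cons] at h
    simp only [listF, Option.mem_def] at h'
    split_ifs at h' <;> rw [Option.map_eq_some_iff] at h'
    · obtain ⟨x, hx, rfl⟩ := h'
      exact List.forall_mem_cons.2 ⟨hp b h.1 x hx, h.2⟩
    · obtain ⟨x, hx, rfl⟩ := h'
      exact List.forall_mem_cons.2 ⟨h.1, forall_listF C i hp l h.2 x hx⟩

lemma sum_listE (C : Crystal B) (i : Fin 2) {r : B → ℕ}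
    (hr : ∀ b, ∀ x ∈ C.e i b, r x + 1 = r b) :
    ∀ l : List B, ∀ l' ∈ C.listE i l, (l'.map r).sum + 1 = (l.map r).sum
  | [], l', h' => by simp [listE] at h'
  | b :: l, l', h' => by
    simp only [listE, Option.mem_def] at h'
    split_ifs at h' <;> rw [Option.map_eq_some_iff] at h'
    · obtain ⟨x, hx, rfl⟩ := h'
      have := hr b x hx
      simp only [List.map_cons, List.sum_cons]
      omega
    · obtain ⟨x, hx, rfl⟩ := h'
      have := sum_listE C i hr l x hx
      simp only [List.map_cons, List.sum_cons]
      omega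

end Crystal

/-! ### Tensor powers as lists -/

/-- The factors of an element of a tensor power. -/
def TPow.toList {B : Type} : {k : ℕ} → TPow B k → List B
  | 0, _ => []
  | _ + 1, w => w.1 :: TPow.toList w.2

lemma TPow.toList_ofFn {B : Type} : ∀ {k : ℕ} (b : Fin k → B), (TPow.ofFn b).toList = List.ofFn b
  | 0, _ => rfl
  | _ + 1, b => by
    rw [List.ofFn_succ, ← TPow.toList_ofFn]
    rfl

lemma TPow.ofFn_surjective {B : Type} : ∀ {k : ℕ}, Function.Surjective (@TPow.ofFn B k)
  | 0, _ => ⟨fun j => j.elim0, rfl⟩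
  | _ + 1, w => by
    obtain ⟨b, hb⟩ := TPow.ofFn_surjective w.2
    exact ⟨Fin.cons w.1 b, Prod.ext rfl hb⟩

namespace Crystal

variable {A B : Type} {C : Crystal A} {D : Crystal B} {g : A → B}

/-- Transport along g allows tensor powers of different crystals to be compared as lists over one
common crystal. -/
lemma IsStrictMorphism.listWt_power (hg : C.IsStrictMorphism D g) :
    ∀ {k : ℕ} (w : TPow A k), D.listWt (w.toList.map g) = (C.power k).wt w
  | 0, _ => rfl
  | _ + 1, w => by
    have := hg.listWt_power w.2
    simp only [TPow.toList, List.map_cons, listWt, this, hg.wt]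
    rfl

lemma IsStrictMorphism.listε_power (hg : C.IsStrictMorphism D g) (i : Fin 2) :
    ∀ {k : ℕ} (w : TPow A k), D.listε i (w.toList.map g) = (C.power k).ε i w
  | 0, _ => rfl
  | _ + 1, w => by
    have := hg.listε_power i w.2
    simp only [TPow.toList, List.map_cons, listε, this, hg.wt, hg.ε]
    rfl

lemma IsStrictMorphism.listφ_power (hg : C.IsStrictMorphism D g) (i : Fin 2) {k : ℕ}
    (w : TPow A k) : D.listφ i (w.toList.map g) = (C.power k).φ i w := by
  rw [listφ_eq, hg.listε_power, hg.listWt_power, φ_eq]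

lemma IsStrictMorphism.listE_power (hg : C.IsStrictMorphism D g) (i : Fin 2) :
    ∀ {k : ℕ} (w : TPow A k),
      D.listE i (w.toList.map g) = ((C.power k).e i w).map fun w => w.toList.map g
  | 0, _ => rfl
  | k + 1, w => by
    have := hg.listE_power i w.2
    simp only [TPow.toList, List.map_cons, listE, this, hg.listε_power, hg.φ, hg.e]
    change _ = Option.map _ (if (C.power k).ε i w.2 ≤ C.φ i w.1 then
      (C.e i w.1).map (fun c => (c, w.2)) else ((C.power k).e i w.2).map (fun c => (w.1, c)))
    split_ifs
    · cases C.e i w.1 <;> rfl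
    · cases (C.power k).e i w.2 <;> rfl

lemma IsStrictMorphism.listF_power (hg : C.IsStrictMorphism D g) (i : Fin 2) :
    ∀ {k : ℕ} (w : TPow A k),
      D.listF i (w.toList.map g) = ((C.power k).f i w).map fun w => w.toList.map g
  | 0, _ => rfl
  | k + 1, w => by
    have := hg.listF_power i w.2
    simp only [TPow.toList, List.map_cons, listF, this, hg.listε_power, hg.φ, hg.f]
    change _ = Option.map _ (if (C.power k).ε i w.2 < C.φ i w.1 then
      (C.f i w.1).map (fun c => (c, w.2)) else ((C.power k).f i w.2).map (fun c => (w.1, c)))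
    split_ifs
    · cases C.f i w.1 <;> rfl
    · cases (C.power k).f i w.2 <;> rfl

end Crystal
namespace Monomial

/-! ### Products of monomials as tensor products

The exponent of `Y i k` contributes the position `2 * k + 1` if it is positive and `2 * k` if it is
negative. -/

/-- All positions of the variables `Y i k` in `M` are at least `p`. -/
def IsAbove (i : Fin 2) (p : ℤ) (M : Monomial) : Prop := ∀ k : ℤ,
  (exponentSum i (Set.Iic (k - 1)) M < exponentSum i (Set.Iic k) M → p ≤ 2 * k + 1) ∧
    (exponentSum i (Set.Iic k) M < exponentSum i (Set.Iic (k - 1)) M → p ≤ 2 * k)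

/-- All positions of the variables `Y i k` in `M` are at most `p`. -/
def IsBelow (i : Fin 2) (p : ℤ) (M : Monomial) : Prop := ∀ k : ℤ,
  (exponentSum i (Set.Iic (k - 1)) M < exponentSum i (Set.Iic k) M → 2 * k + 1 ≤ p) ∧
    (exponentSum i (Set.Iic k) M < exponentSum i (Set.Iic (k - 1)) M → 2 * k ≤ p)

lemma IsAbove.mono {i : Fin 2} {p q : ℤ} {M : Monomial} (h : IsAbove i p M) (hq : q ≤ p) :
    IsAbove i q M :=
  fun k => ⟨fun h' => hq.trans ((h k).1 h'), fun h' => hq.trans ((h k).2 h')⟩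

lemma IsBelow.mono {i : Fin 2} {p q : ℤ} {M : Monomial} (h : IsBelow i p M) (hq : p ≤ q) :
    IsBelow i q M :=
  fun k => ⟨fun h' => ((h k).1 h').trans hq, fun h' => ((h k).2 h').trans hq⟩

/-- The exponents at k add up, and a sum that is positive (negative) has a positive (negative)
summand. -/
lemma IsAbove.mul {i : Fin 2} {p : ℤ} {M N : Monomial} (hM : IsAbove i p M) (hN : IsAbove i p N) :
    IsAbove i p (M * N) := by
  intro k
  have h1 := hM k
  have h2 := hN k
  simp only [exponentSum_mul]
  omega

lemma IsBelow.mul {i : Fin 2} {p : ℤ} {M N : Monomial} (hM : IsBelow i p M) (hN : IsBelow i p N) :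
    IsBelow i p (M * N) := by
  intro k
  have h1 := hM k
  have h2 := hN k
  simp only [exponentSum_mul]
  omega

lemma isBelow_one (i : Fin 2) (p : ℤ) : IsBelow i p 1 := by
  intro k
  simp [exponentSum_one]

/-- Up to k there are no variables, so the partial sums are constant there, and they vanish far to
the left. -/
lemma IsAbove.exponentSum_eq_zero {i : Fin 2} {p : ℤ} {M : Monomial} (h : IsAbove i p M) {k : ℤ}
    (hk : 2 * k + 1 < p) : exponentSum i (Set.Iic k) M = 0 := by
  obtain ⟨N, hN⟩ := exists_stable i M
  have key : ∀ n : ℕ, exponentSum i (Set.Iic (k - n)) M = exponentSum i (Set.Iic k) M := by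
    intro n
    induction n with
    | zero => simp
    | succ n ih =>
      have h1 := h (k - n)
      rw [show k - n - 1 = k - (n + 1 : ℕ) by push_cast; ring] at h1
      omega
  rw [← key (k + N).toNat]
  exact (hN _).1 (by omega)

lemma IsBelow.exponentSum_eq_wt {i : Fin 2} {p : ℤ} {M : Monomial} (h : IsBelow i p M) {k : ℤ}
    (hk : p < 2 * (k + 1)) : exponentSum i (Set.Iic k) M = wt M i := by
  obtain ⟨N, hN⟩ := exists_stable i M
  have key : ∀ n : ℕ, exponentSum i (Set.Iic (k + n)) M = exponentSum i (Set.Iic k) M := by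
    intro n
    induction n with
    | zero => simp
    | succ n ih =>
      have h1 := h (k + (n + 1 : ℕ))
      rw [show k + (n + 1 : ℕ) - 1 = k + n by push_cast; ring] at h1
      omega
  rw [← key (N - k).toNat]
  exact (hN _).2 (by omega)

section mul

variable {i : Fin 2} {p : ℤ} {M N : Monomial}

/-- The index c = ⌊p/2⌋ is the only one where both monomials can have exponents. If p is odd, the
exponent of M at c is nonnegative; if p is even, that of N is nonpositive. Merging the two exponents
skips the partial sum wt N, and either alternative makes it at most one of its two neighbours, so no
maximum is lost. -/
lemma exists_separation (hM : IsAbove i p M) (hN : IsBelow i p N) : ∃ c : ℤ,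
    (∀ k < c, exponentSum i (Set.Iic k) M = 0) ∧
    (∀ k, c ≤ k → exponentSum i (Set.Iic k) N = wt N i) ∧
    (0 ≤ exponentSum i (Set.Iic c) M ∨ wt N i ≤ exponentSum i (Set.Iic (c - 1)) N) := by
  refine ⟨p / 2, fun k hk => hM.exponentSum_eq_zero (by omega),
    fun k hk => hN.exponentSum_eq_wt (by omega), ?_⟩
  have h1 := hM (p / 2)
  have h2 := hN (p / 2)
  have h3 := hM.exponentSum_eq_zero (k := p / 2 - 1) (by omega)
  have h4 := hN.exponentSum_eq_wt (k := p / 2) (by omega)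
  omega

lemma φ_mul (hM : IsAbove i p M) (hN : IsBelow i p N) :
    φ i (M * N) = max (φ i N) (φ i M + wt N i) := by
  obtain ⟨c, h1, h2, h3⟩ := exists_separation hM hN
  have hMN : ∀ k, exponentSum i (Set.Iic k) (M * N) =
      exponentSum i (Set.Iic k) M + exponentSum i (Set.Iic k) N :=
    fun k => exponentSum_mul i _ M N
  have hle : ∀ k, exponentSum i (Set.Iic k) (M * N) ≤ max (φ i N) (φ i M + wt N i) := by
    intro k
    have h4 := le_φ i M k
    have h5 := le_φ i N k
    have h6 := hMN k
    rcases lt_or_ge k c with hk | hk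
    · have := h1 k hk
      omega
    · have := h2 k hk
      omega
  obtain ⟨k, hk⟩ := exists_eq_φ i M
  obtain ⟨l, hl⟩ := exists_eq_φ i N
  have hφM := φ_nonneg i M
  have hφN := φ_nonneg i N
  have h5 := hMN k
  have h6 := hMN l
  have h7 := hMN c
  have h8 := hMN (c - 1)
  have h9 := h1 (c - 1) (by omega)
  have h10 := h2 c le_rfl
  have h11 := le_φ i M c
  have h12 := le_φ i N (c - 1)
  -- A peak k of M below c means φ M = 0, and a peak l of N from c on means φ N = wt N. In these
  -- degenerate cases the maximum may have to be sought at c or c - 1, where the separation applies.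
  have hex : ∃ k, exponentSum i (Set.Iic k) (M * N) = max (φ i N) (φ i M + wt N i) := by
    rcases lt_or_ge k c with hkc | hkc
    · have := h1 k hkc
      rcases lt_or_ge l c with hlc | hlc
      · have := h1 l hlc
        rcases h3 with h3 | h3
        · rcases le_or_gt (φ i M + wt N i) (φ i N) with h | h
          · exact ⟨l, by omega⟩
          · exact ⟨c, by omega⟩
        · exact ⟨l, by omega⟩
      · have := h2 l hlc
        rcases h3 with h3 | h3
        · exact ⟨c, by omega⟩
        · exact ⟨c - 1, by omega⟩
    · have := h2 k hkc
      rcases lt_or_ge l c with hlc | hlc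
      · have := h1 l hlc
        rcases le_or_gt (φ i M + wt N i) (φ i N) with h | h
        · exact ⟨l, by omega⟩
        · exact ⟨k, by omega⟩
      · have := h2 l hlc
        exact ⟨k, by omega⟩
  obtain ⟨k, hk⟩ := hex
  exact φ_eq_of hle hk

/-- The variables of N come before those of M up to a common index, and `nf` takes the smallest
peak. So a tie between φ N and φ M + wt N goes to N, which is the strict inequality in Kashiwara's
rule for f_i. -/
lemma f_mul (hM : IsAbove i p M) (hN : IsBelow i p N) :
    f i (M * N) = if ε i N < φ i M then (f i M).map (· * N) else (f i N).map (M * ·) := by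
  obtain ⟨c, h1, h2, h3⟩ := exists_separation hM hN
  have hMN : ∀ k, exponentSum i (Set.Iic k) (M * N) =
      exponentSum i (Set.Iic k) M + exponentSum i (Set.Iic k) N :=
    fun k => exponentSum_mul i _ M N
  have hφ := φ_mul hM hN
  have hφN := φ_eq i N
  have hφM0 := φ_nonneg i M
  have hφN0 := φ_nonneg i N
  have hεN0 := ε_nonneg i N
  split_ifs with h
  · have hM0 : φ i M ≠ 0 := by omega
    obtain ⟨h4, h5⟩ := nf_spec hM0
    have hc : c ≤ nf i M := by
      by_contra hlt
      have := h1 _ (not_le.1 hlt)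
      omega
    have h6 : nf i (M * N) = nf i M := by
      refine nf_eq_of ?_ fun l hl => ?_
      · have := h2 _ hc
        have := hMN (nf i M)
        omega
      · have := h5 l hl
        have := hMN l
        have := le_φ i M l
        have := le_φ i N l
        rcases lt_or_ge l c with hlc | hlc
        · have := h1 l hlc
          omega
        · have := h2 l hlc
          omega
    simp only [f]
    rw [if_neg (by omega), if_neg hM0, h6, Option.map_some, mul_assoc]
  · have h7 : φ i (M * N) = φ i N := by omega
    by_cases hN0 : φ i N = 0
    · simp only [f]
      rw [if_pos (by omega), if_pos hN0, Option.map_none]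
    · obtain ⟨h4, h5⟩ := nf_spec hN0
      have hc : nf i N ≤ c := by
        by_contra hlt
        have h8 := h2 c le_rfl
        have h9 := h2 (nf i N) (by omega)
        have := h5 c (by omega)
        omega
      have h6 : nf i (M * N) = nf i N := by
        refine nf_eq_of ?_ fun l hl => ?_
        · have h8 := hMN (nf i N)
          rcases hc.lt_or_eq with hlt | heq
          · have := h1 _ hlt
            omega
          -- Here the first peak of N is at c, so N has a positive exponent there and the separation
          -- gives M a nonnegative one. It is at most φ M ≤ ε N = φ N - wt N = 0, hence zero.
          · have := h2 c le_rfl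
            have := h5 (c - 1) (by omega)
            have := le_φ i N (c - 1)
            have := le_φ i M c
            rw [heq] at h4 h8 ⊢
            omega
        · have := h5 l hl
          have := h1 l (by omega)
          have := hMN l
          omega
      simp only [f]
      rw [if_neg (by omega), if_neg hN0, h6, Option.map_some, mul_left_comm]

end mul

/-! ### The monomials of letters -/

/-- A lower bound for the positions of `X a 1`. -/
def letterLo : Fin 2 → Letter → ℤ
  | 0, .one => 3 | 0, .two => 4 | 0, .three => 5 | 0, .zero => 5
  | 0, .bar3 => 6 | 0, .bar2 => 7 | 0, .bar1 => 8
  | 1, .two => 3 | 1, .three => 4 | 1, .bar3 => 5 | 1, .bar2 => 6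
  -- These letters contain no Y_2, so any bound holds; 100 and -100 play the part of ±∞.
  | 1, _ => 100

/-- An upper bound for the positions of `X a 1`. -/
def letterHi : Fin 2 → Letter → ℤ
  | 0, .one => 3 | 0, .two => 4 | 0, .three => 5 | 0, .zero => 6
  | 0, .bar3 => 6 | 0, .bar2 => 7 | 0, .bar1 => 8
  | 1, .two => 3 | 1, .three => 4 | 1, .bar3 => 5 | 1, .bar2 => 6
  | 1, _ => -100

lemma eq_zero_or_eq_one (i : Fin 2) : i = 0 ∨ i = 1 := by omega

/-- For the letter 0 in the Y_1 direction the two exponents cancel, so the partial sum is nonzero at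
a single index. -/
lemma exponentSum_X (i : Fin 2) (a : Letter) (k l : ℤ) :
    exponentSum i (Set.Iic l) (X a k) = match i, a with
      | 0, .one => if k ≤ l then 1 else 0
      | 0, .two => if k + 1 ≤ l then -1 else 0
      | 0, .three => if k + 1 ≤ l then 2 else 0
      | 0, .zero => if k + 1 = l then 1 else 0
      | 0, .bar3 => if k + 2 ≤ l then -2 else 0
      | 0, .bar2 => if k + 2 ≤ l then 1 else 0
      | 0, .bar1 => if k + 3 ≤ l then -1 else 0
      | 1, .two => if k ≤ l then 1 else 0
      | 1, .three => if k + 1 ≤ l then -1 else 0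
      | 1, .bar3 => if k + 1 ≤ l then 1 else 0
      | 1, .bar2 => if k + 2 ≤ l then -1 else 0
      | 1, _ => 0 := by
  classical
  obtain rfl | rfl := eq_zero_or_eq_one i <;> cases a <;>
    simp [X, exponentSum_mul, exponentSum_inv, exponentSum_Y, pow_succ] <;> split_ifs <;> omega

lemma isAbove_X (i : Fin 2) (a : Letter) (k : ℤ) :
    IsAbove i (letterLo i a + 2 * (k - 1)) (X a k) := by
  intro l
  simp only [exponentSum_X]
  obtain rfl | rfl := eq_zero_or_eq_one i <;> cases a <;> simp only [letterLo] <;> (try split_ifs) <;> omega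

lemma isBelow_X (i : Fin 2) (a : Letter) (k : ℤ) :
    IsBelow i (letterHi i a + 2 * (k - 1)) (X a k) := by
  intro l
  simp only [exponentSum_X]
  obtain rfl | rfl := eq_zero_or_eq_one i <;> cases a <;> simp only [letterHi] <;> (try split_ifs) <;> omega

lemma wt_X (a : Letter) (k : ℤ) : wt (X a k) = a.wt := by
  classical
  funext i
  obtain rfl | rfl := eq_zero_or_eq_one i <;> cases a <;>
    simp [wt, X, Letter.wt, exponentSum_mul, exponentSum_inv, exponentSum_Y, pow_succ]

/-- The smallest `k` at which the maximum `φ i (X a 0)` is attained, if it is positive. -/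
def letterPeak : Fin 2 → Letter → ℤ
  | 0, .one => 0 | 0, .three => 1 | 0, .zero => 1 | 0, .bar2 => 2
  | 1, .two => 0 | 1, .bar3 => 1
  | _, _ => -1

lemma φ_X (i : Fin 2) (a : Letter) (k : ℤ) : φ i (X a k) = Letter.φ i a := by
  -- Where φ vanishes, the default -1 of `letterPeak` gives the index k - 1, which precedes all
  -- variables of `X a k`.
  refine φ_eq_of (k := k + letterPeak i a) (fun l => ?_) ?_ <;> rw [exponentSum_X] <;>
    obtain rfl | rfl := eq_zero_or_eq_one i <;> cases a <;> simp only [Letter.φ, letterPeak] <;> (try split_ifs) <;> omega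

lemma ε_X (i : Fin 2) (a : Letter) (k : ℤ) : ε i (X a k) = Letter.ε i a := by
  have h1 := φ_eq i (X a k)
  have h2 : Letter.φ i a = Letter.ε i a + a.wt i := B1.φ_eq i a
  rw [φ_X, wt_X] at h1
  omega

/-- Dividing by A_i at the peak turns the monomial of a letter into that of the next one, so for
each k the monomials `X a k` form a copy of B(Λ₁). -/
lemma f_X (i : Fin 2) (a : Letter) (k : ℤ) :
    f i (X a k) = (Letter.f i a).map (X · k) := by
  by_cases h : Letter.φ i a = 0
  · rw [f, if_pos (by rw [φ_X, h])]
    revert h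
    obtain rfl | rfl := eq_zero_or_eq_one i <;> cases a <;> simp [Letter.φ, Letter.f]
  · have h1 : nf i (X a k) = k + letterPeak i a := by
      refine nf_eq_of ?_ fun l hl => ?_ <;> rw [exponentSum_X, φ_X] <;> revert h
      · obtain rfl | rfl := eq_zero_or_eq_one i <;> cases a <;> simp [Letter.φ, letterPeak]
      · revert hl
        obtain rfl | rfl := eq_zero_or_eq_one i <;> cases a <;>
          simp only [Letter.φ, letterPeak, not_true_eq_false, IsEmpty.forall_iff, implies_true] <;>
          intros <;> (try split_ifs) <;> omega
    rw [f, if_neg (by rwa [φ_X]), h1]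
    revert h
    -- Each remaining case is an identity of Laurent monomials, checked additively on exponents.
    obtain rfl | rfl := eq_zero_or_eq_one i <;> cases a <;>
      simp only [Letter.φ, Letter.f, X, A, letterPeak, Option.map_some, Option.map_none,
        add_assoc, Option.some.injEq, inv_mul_eq_iff_eq_mul] <;> norm_num <;>
      apply Multiplicative.toAdd.injective <;> simp <;> try abel

end Monomial

/-! ### Monomials of cells and of good lists -/

open Crystal Monomial

namespace Monomial

lemma φ_one (i : Fin 2) : φ i 1 = 0 :=
  φ_eq_of (k := 0) (fun _ => (exponentSum_one i _).le) (exponentSum_one i _)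

lemma wt_one : wt 1 = 0 := funext fun i => exponentSum_one i _

lemma f_one (i : Fin 2) : f i 1 = none := if_pos (φ_one i)

lemma isAbove_one (i : Fin 2) (p : ℤ) : IsAbove i p 1 := by
  intro k
  simp [exponentSum_one]

end Monomial

namespace Cell

/-- The monomial of the upper entry of a cell. -/
noncomputable def topMonomial (a : Option Letter) : Monomial := a.elim 1 (X · 2)

/-- The monomial of a cell. -/
noncomputable def monomial (c : Cell) : Monomial := topMonomial c.1 * X c.2 1

/-- A lower bound for the positions of the monomial of the upper entry of a cell. -/
def topLo (i : Fin 2) (a : Option Letter) : ℤ := a.elim 100 (letterLo i · + 2)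

/-- An upper bound for the positions of the monomial of the upper entry of a cell. -/
def topHi (i : Fin 2) (a : Option Letter) : ℤ := a.elim (-100) (letterHi i · + 2)

/-- The columns whose monomial involves no variable `Y 0 k`. -/
def IsTrivial (i : Fin 2) (c : Cell) : Prop :=
  i = 0 ∧ (c = (some .one, .two) ∨ c = (some .bar2, .bar1))

instance (i : Fin 2) : DecidablePred (IsTrivial i) := fun c =>
  inferInstanceAs (Decidable (i = 0 ∧ (c = (some .one, .two) ∨ c = (some .bar2, .bar1))))

/-- A lower bound for the positions of the monomial of a cell. -/
def lo (i : Fin 2) (c : Cell) : ℤ :=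
  if IsTrivial i c then 100 else min (topLo i c.1) (letterLo i c.2)

/-- An upper bound for the positions of the monomial of a cell. -/
def hi (i : Fin 2) (c : Cell) : ℤ :=
  if IsTrivial i c then -100 else max (topHi i c.1) (letterHi i c.2)

/-- Here the tableau conditions enter: positions decrease weakly from right to left. The letter 0
must not repeat in a row because X_0(1) has the Y_1-positions 5 and 6. The trivial columns may
repeat although their letters give the Y_1-bounds 4, 5 and 8, 9; their Y_1 factors cancel, which is
why they are treated apart. -/
lemma hi_le_lo : ∀ i c d, Rel c d → hi i d ≤ lo i c := by decide +kernel

/-- For Y_1 this inequality reflects the bound on the distance inside a column. It makes X_a(2)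
X_b(1) behave as a ⊗ b. -/
lemma letterHi_le_topLo : ∀ i c, Valid c → letterHi i c.2 ≤ topLo i c.1 := by decide +kernel

lemma isAbove_topMonomial (i : Fin 2) : ∀ a, IsAbove i (topLo i a) (topMonomial a)
  | none => isAbove_one i _
  | some a => (isAbove_X i a 2).mono (by simp [topLo])

lemma isBelow_topMonomial (i : Fin 2) : ∀ a, IsBelow i (topHi i a) (topMonomial a)
  | none => isBelow_one i _
  | some a => (isBelow_X i a 2).mono (by simp [topHi])

lemma exponentSum_monomial_of_isTrivial {i : Fin 2} {c : Cell} (h : IsTrivial i c) (k : ℤ) :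
    exponentSum i (Set.Iic k) c.monomial = 0 := by
  obtain ⟨rfl, rfl | rfl⟩ := h <;>
    simp only [monomial, topMonomial, Option.elim, exponentSum_mul, exponentSum_X] <;>
    split_ifs <;> omega

lemma isAbove_monomial (i : Fin 2) (c : Cell) : IsAbove i (lo i c) c.monomial := by
  unfold lo
  split_ifs with h
  · intro k
    simp [exponentSum_monomial_of_isTrivial h]
  · exact ((isAbove_topMonomial i c.1).mono (min_le_left _ _)).mul
      ((isAbove_X i c.2 1).mono (by simp))

lemma isBelow_monomial (i : Fin 2) (c : Cell) : IsBelow i (hi i c) c.monomial := by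
  unfold hi
  split_ifs with h
  · intro k
    simp [exponentSum_monomial_of_isTrivial h]
  · exact ((isBelow_topMonomial i c.1).mono (le_max_left _ _)).mul
      ((isBelow_X i c.2 1).mono (by simp))

lemma wt_topMonomial : ∀ a, wt (topMonomial a) = optB1.wt a
  | none => wt_one
  | some a => wt_X a 2

lemma φ_topMonomial (i : Fin 2) : ∀ a, φ i (topMonomial a) = optB1.φ i a
  | none => φ_one i
  | some a => φ_X i a 2

lemma f_topMonomial (i : Fin 2) : ∀ a, f i (topMonomial a) = (optB1.f i a).map topMonomial
  | none => f_one i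
  | some a => by
    rw [show topMonomial (some a) = X a 2 from rfl, f_X]
    change _ = Option.map topMonomial ((Letter.f i a).map some)
    rw [Option.map_map]
    rfl

lemma wt_monomial (c : Cell) : wt c.monomial = cellCrystal.wt c := by
  rw [monomial, wt_mul, wt_topMonomial, wt_X]
  rfl

lemma φ_monomial (i : Fin 2) {c : Cell} (h : c.Valid) : φ i c.monomial = cellCrystal.φ i c := by
  rw [monomial, φ_mul ((isAbove_topMonomial i c.1).mono (letterHi_le_topLo i c h))
    ((isBelow_X i c.2 1).mono (by simp)), φ_X, wt_X, φ_topMonomial]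
  rfl

lemma f_monomial (i : Fin 2) {c : Cell} (h : c.Valid) :
    f i c.monomial = (cellCrystal.f i c).map monomial := by
  rw [monomial, f_mul ((isAbove_topMonomial i c.1).mono (letterHi_le_topLo i c h))
    ((isBelow_X i c.2 1).mono (by simp)), ε_X, φ_topMonomial, f_X, f_topMonomial]
  change _ = Option.map monomial (if Letter.ε i c.2 < optB1.φ i c.1 then
    (optB1.f i c.1).map fun x => (x, c.2) else (Letter.f i c.2).map fun x => (c.1, x))
  split_ifs <;> rw [Option.map_map, Option.map_map] <;> rfl

lemma isSeminormal : cellCrystal.IsSeminormal := ⟨ε_nonneg, φ_nonneg, ε_eq_zero_of_e⟩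

lemma isStable : cellCrystal.IsStable Rel := ⟨rel_e_left, rel_e_right, rel_f_left, rel_f_right⟩

/-- The condition for a list to consist of the cells of a tableau, from right to left. -/
def IsGood (l : List Cell) : Prop := (∀ c ∈ l, c.Valid) ∧ l.IsChain Rel

lemma IsGood.pairwise {l : List Cell} (h : IsGood l) : l.Pairwise Rel :=
  List.isChain_iff_pairwise.1 h.2

lemma IsGood.tail {c : Cell} {l : List Cell} (h : IsGood (c :: l)) : IsGood l :=
  ⟨fun d hd => h.1 d (List.mem_cons_of_mem _ hd), h.2.tail⟩

lemma IsGood.listE {l l' : List Cell} {i : Fin 2} (h : IsGood l)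
    (h' : cellCrystal.listE i l = some l') : IsGood l' :=
  ⟨forall_listE _ i (valid_e i) l h.1 l' h', isStable.isChain_listE i l h.2 l' h'⟩

lemma IsGood.listF {l l' : List Cell} {i : Fin 2} (h : IsGood l)
    (h' : cellCrystal.listF i l = some l') : IsGood l' :=
  ⟨forall_listF _ i (valid_f i) l h.1 l' h', isStable.isChain_listF i l h.2 l' h'⟩

/-- The product of the monomials of the cells in a list. -/
noncomputable def listMonomial (l : List Cell) : Monomial := (l.map monomial).prod

lemma listMonomial_cons (c : Cell) (l : List Cell) :
    listMonomial (c :: l) = c.monomial * listMonomial l := by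
  simp [listMonomial]

lemma isBelow_listMonomial {i : Fin 2} {p : ℤ} :
    ∀ l : List Cell, (∀ c ∈ l, hi i c ≤ p) → IsBelow i p (listMonomial l)
  | [], _ => isBelow_one i p
  | c :: l, h => by
    rw [List.forall_mem_cons] at h
    rw [listMonomial_cons]
    exact ((isBelow_monomial i c).mono h.1).mul (isBelow_listMonomial l h.2)

/-- Transitivity of `Rel` compares c with every later cell and not only with the next one, so the
product splits off its first factor as a tensor product does. -/
lemma IsGood.isBelow_listMonomial {c : Cell} {l : List Cell} (h : IsGood (c :: l)) (i : Fin 2) :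
    IsBelow i (lo i c) (listMonomial l) :=
  Cell.isBelow_listMonomial l fun d hd => hi_le_lo i c d (List.rel_of_pairwise_cons h.pairwise hd)

lemma wt_listMonomial : ∀ l, wt (listMonomial l) = cellCrystal.listWt l
  | [] => wt_one
  | c :: l => by rw [listMonomial_cons, wt_mul, wt_monomial, wt_listMonomial l]; rfl

lemma IsGood.φ_listMonomial (i : Fin 2) :
    ∀ {l : List Cell}, IsGood l → φ i (listMonomial l) = cellCrystal.listφ i l
  | [], _ => φ_one i
  | c :: l, h => by
    rw [listMonomial_cons, φ_mul (isAbove_monomial i c) (h.isBelow_listMonomial i),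
      φ_listMonomial i h.tail, φ_monomial i (h.1 c List.mem_cons_self), wt_listMonomial]
    rfl

lemma IsGood.ε_listMonomial (i : Fin 2) {l : List Cell} (h : IsGood l) :
    ε i (listMonomial l) = cellCrystal.listε i l := by
  have h1 := φ_eq i (listMonomial l)
  have h2 := cellCrystal.listφ_eq i l
  rw [h.φ_listMonomial, wt_listMonomial] at h1
  omega

lemma IsGood.f_listMonomial (i : Fin 2) : ∀ {l : List Cell}, IsGood l →
    f i (listMonomial l) = (cellCrystal.listF i l).map listMonomial
  | [], _ => f_one i
  | c :: l, h => by
    rw [listMonomial_cons, f_mul (isAbove_monomial i c) (h.isBelow_listMonomial i),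
      f_listMonomial i h.tail, h.tail.ε_listMonomial, φ_monomial i (h.1 c List.mem_cons_self),
      f_monomial i (h.1 c List.mem_cons_self), Crystal.listF]
    split_ifs <;> simp only [Option.map_map, Function.comp_def, listMonomial_cons]

/-- The first cell has ε at most that of the word, so it is a highest weight cell. Behind columns 1
⊗ 2 only the single letter 2 could spoil the claim. The Λ₁-coordinate of the weight of 1 ⊗ 2 is 0,
so these columns cannot compensate ε_1(2) = 1. -/
lemma IsGood.forall_mem_of_listε_eq_zero {l : List Cell} (h : IsGood l)
    (hε : ∀ i, cellCrystal.listε i l = 0) : ∀ c ∈ l, c = (some .one, .two) ∨ c = (none, .one) := by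
  have key : ∀ l, IsGood l → cellCrystal.listε 0 l ≤ 0 →
      (∀ c ∈ l, c = (some .one, .two) ∨ c = (none, .one) ∨ c = (none, .two)) →
      ∀ c ∈ l, c = (some .one, .two) ∨ c = (none, .one) := by
    intro l
    induction l with
    | nil => simp
    | cons c l ih =>
      intro h h' hl
      rw [List.forall_mem_cons] at hl ⊢
      have h1 : cellCrystal.listε 0 (c :: l) =
        max (cellCrystal.ε 0 c) (cellCrystal.listε 0 l - cellCrystal.wt c 0) := rfl
      rcases hl.1 with rfl | rfl | rfl
      · refine ⟨.inl rfl, ih h.tail ?_ hl.2⟩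
        have h2 : cellCrystal.wt (some .one, .two) 0 = 0 := by decide
        omega
      · refine ⟨.inr rfl, fun d hd => .inr (rel_one d (List.rel_of_pairwise_cons h.pairwise hd))⟩
      · have h2 : cellCrystal.ε 0 (none, .two) = 1 := by decide
        omega
  cases l with
  | nil => simp
  | cons c l =>
    have hc := highest c (h.1 c List.mem_cons_self) fun i => by
      have h1 := hε i
      have h2 := ε_nonneg i c
      simp only [listε] at h1
      omega
    rcases hc with rfl | rfl
    · refine key _ h (hε 0).le (List.forall_mem_cons.2 ⟨.inl rfl, fun d hd => ?_⟩)
      exact rel_column_one_two d (List.rel_of_pairwise_cons h.pairwise hd)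
    · exact List.forall_mem_cons.2 ⟨.inr rfl, fun d hd =>
        .inr (rel_one d (List.rel_of_pairwise_cons h.pairwise hd))⟩

end Cell

/-! ### B(Λ₁) and B(Λ₂) inside the crystal of cells -/

lemma Crystal.IsStrictMorphism.comp {A B D : Type*} {C : Crystal A} {C' : Crystal B}
    {C'' : Crystal D} {g : B → D} {h : A → B} (hg : C'.IsStrictMorphism C'' g)
    (hh : C.IsStrictMorphism C' h) : C.IsStrictMorphism C'' (g ∘ h) where
  wt a := (hg.wt _).trans (hh.wt a)
  ε i a := (hg.ε i _).trans (hh.ε i a)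
  φ i a := (hg.φ i _).trans (hh.φ i a)
  e i a := by rw [Function.comp, hg.e, hh.e, Option.map_map]
  f i a := by rw [Function.comp, hg.f, hh.f, Option.map_map]

namespace Cell

/-- The cell with one entry. -/
def ofLetter (b : Letter) : Cell := (none, b)

/-- The cell given by a column. -/
def ofColumn (c : Column) : Cell := (some c.1.1, c.1.2)

lemma ofLetter_injective : Function.Injective ofLetter := fun _ _ h => congrArg Prod.snd h

lemma ofColumn_injective : Function.Injective ofColumn := fun _ _ h =>
  Subtype.ext (Prod.ext (Option.some.inj (Prod.ext_iff.1 h).1) (Prod.ext_iff.1 h).2)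

lemma ofLetter_strict : B1.IsStrictMorphism cellCrystal ofLetter where
  wt := by decide
  ε := by decide
  φ := by decide
  e := by decide
  f := by decide

lemma pair_strict :
    (B1.tensor B1).IsStrictMorphism cellCrystal fun c => (some c.1, c.2) where
  wt := by decide +kernel
  ε := by decide +kernel
  φ := by decide +kernel
  e := by decide +kernel
  f := by decide +kernel

lemma ofColumn_strict : B2.IsStrictMorphism cellCrystal ofColumn :=
  pair_strict.comp (component_strict _ _)

end Cell

/-- A property that is stable under all Kashiwara operators is constant on connected components. -/
lemma Crystal.Connected.iff_of_stable {B : Type*} {C : Crystal B} {p : B → Prop}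
    (he : ∀ i b c, C.e i b = some c → p b → p c) (hf : ∀ i b c, C.f i b = some c → p b → p c)
    {b c : B} (h : C.Connected b c) : p b ↔ p c := by
  induction h with
  | rel b c h =>
    obtain ⟨i, h⟩ := h
    exact ⟨hf i b c h, he i c b ((C.f_iff i b c).1 h)⟩
  | refl => rfl
  | symm _ _ _ ih => exact ih.symm
  | trans _ _ _ _ _ ih ih' => exact ih.trans ih'

/-! ### Good words, their component and their monomials -/

namespace Words

variable {m n : ℕ}

/-- The cells of an element of `B(Λ₂)^{⊗ n} ⊗ B(Λ₁)^{⊗ m}`. -/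
def cells (w : Words m n) : List Cell :=
  w.1.toList.map Cell.ofColumn ++ w.2.toList.map Cell.ofLetter

lemma listWt_cells (w : Words m n) : cellCrystal.listWt w.cells = (wordCrystal m n).wt w := by
  rw [cells, listWt_append, Cell.ofColumn_strict.listWt_power, Cell.ofLetter_strict.listWt_power]
  rfl

lemma listε_cells (i : Fin 2) (w : Words m n) :
    cellCrystal.listε i w.cells = (wordCrystal m n).ε i w := by
  rw [cells, Cell.isSeminormal.listε_append, Cell.ofColumn_strict.listWt_power,
    Cell.ofColumn_strict.listε_power, Cell.ofLetter_strict.listε_power]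
  rfl

lemma listφ_cells (i : Fin 2) (w : Words m n) :
    cellCrystal.listφ i w.cells = (wordCrystal m n).φ i w := by
  rw [listφ_eq, listε_cells, listWt_cells, Crystal.φ_eq]

lemma listE_cells (i : Fin 2) (w : Words m n) :
    cellCrystal.listE i w.cells = ((wordCrystal m n).e i w).map cells := by
  rw [cells, Cell.isSeminormal.listE_append, Cell.ofLetter_strict.listε_power,
    Cell.ofColumn_strict.listφ_power, Cell.ofColumn_strict.listE_power,
    Cell.ofLetter_strict.listE_power]
  change _ = Option.map cells (if (B1.power m).ε i w.2 ≤ (B2.power n).φ i w.1 then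
    ((B2.power n).e i w.1).map fun c => (c, w.2) else ((B1.power m).e i w.2).map fun c => (w.1, c))
  split_ifs <;> simp only [Option.map_map] <;> rfl

lemma listF_cells (i : Fin 2) (w : Words m n) :
    cellCrystal.listF i w.cells = ((wordCrystal m n).f i w).map cells := by
  rw [cells, Cell.isSeminormal.listF_append, Cell.ofLetter_strict.listε_power,
    Cell.ofColumn_strict.listφ_power, Cell.ofColumn_strict.listF_power,
    Cell.ofLetter_strict.listF_power]
  change _ = Option.map cells (if (B1.power m).ε i w.2 < (B2.power n).φ i w.1 then
    ((B2.power n).f i w.1).map fun c => (c, w.2) else ((B1.power m).f i w.2).map fun c => (w.1, c))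
  split_ifs <;> simp only [Option.map_map] <;> rfl

/-- The condition on an element of `B(Λ₂)^{⊗ n} ⊗ B(Λ₁)^{⊗ m}` to come from a tableau. -/
def IsGood (w : Words m n) : Prop := Cell.IsGood w.cells

/-- The monomial of an element of `B(Λ₂)^{⊗ n} ⊗ B(Λ₁)^{⊗ m}`. -/
noncomputable def monomial (w : Words m n) : Monomial := Cell.listMonomial w.cells

lemma IsGood.e {i : Fin 2} {w w' : Words m n} (h : w.IsGood)
    (h' : (wordCrystal m n).e i w = some w') : w'.IsGood :=
  Cell.IsGood.listE h (by rw [listE_cells, h']; rfl)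

lemma IsGood.f {i : Fin 2} {w w' : Words m n} (h : w.IsGood)
    (h' : (wordCrystal m n).f i w = some w') : w'.IsGood :=
  Cell.IsGood.listF h (by rw [listF_cells, h']; rfl)

lemma IsGood.f_monomial {w : Words m n} (h : w.IsGood) (i : Fin 2) :
    Monomial.f i w.monomial = ((wordCrystal m n).f i w).map monomial := by
  rw [monomial, Cell.IsGood.f_listMonomial i h, listF_cells, Option.map_map]
  rfl

lemma IsGood.φ_monomial {w : Words m n} (h : w.IsGood) (i : Fin 2) :
    Monomial.φ i w.monomial = (wordCrystal m n).φ i w := by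
  rw [monomial, Cell.IsGood.φ_listMonomial i h, listφ_cells]

lemma IsGood.ε_monomial {w : Words m n} (h : w.IsGood) (i : Fin 2) :
    Monomial.ε i w.monomial = (wordCrystal m n).ε i w := by
  rw [monomial, Cell.IsGood.ε_listMonomial i h, listε_cells]

lemma wt_monomial (w : Words m n) : Monomial.wt w.monomial = (wordCrystal m n).wt w := by
  rw [monomial, Cell.wt_listMonomial, listWt_cells]

lemma ε_eq_zero {i : Fin 2} {w : Words m n} (h : (wordCrystal m n).e i w = none) :
    (wordCrystal m n).ε i w = 0 := by
  rw [← listε_cells]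
  exact Cell.isSeminormal.listε_eq_zero i _ (by rw [listE_cells, h]; rfl)

/-- The product rule is available for f_i only. If e_i acts on the word, invert the arrow f_i, which
commutes with taking monomials; if not, ε_i of the word is 0 and e_i kills the monomial too. -/
lemma IsGood.e_monomial {w : Words m n} (h : w.IsGood) (i : Fin 2) :
    Monomial.e i w.monomial = ((wordCrystal m n).e i w).map monomial := by
  rcases he : (wordCrystal m n).e i w with _ | v
  · rw [Monomial.e, if_pos (by rw [h.ε_monomial, ε_eq_zero he])]
    rfl
  · refine (Monomial.crystal.f_iff i _ _).1 ((h.e he).f_monomial i |>.trans ?_)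
    rw [((wordCrystal m n).f_iff i _ _).2 he]
    rfl

/-- The sum of the positions of all letters. -/
def rank (w : Words m n) : ℕ := (w.cells.map Cell.rank).sum

lemma rank_lt {i : Fin 2} {w w' : Words m n} (h : (wordCrystal m n).e i w = some w') :
    w'.rank < w.rank := by
  have := sum_listE cellCrystal i (Cell.rank_e i) w.cells w'.cells
    (by rw [listE_cells, h]; rfl)
  simp only [rank]
  omega

lemma cells_ofFn (c : Fin n → Column) (d : Fin m → Letter) :
    cells (TPow.ofFn c, TPow.ofFn d) =
      List.ofFn (Fin.append (Cell.ofColumn ∘ c) (Cell.ofLetter ∘ d)) := by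
  rw [cells, TPow.toList_ofFn, TPow.toList_ofFn, List.map_ofFn, List.map_ofFn,
    List.ofFn_fin_append]

lemma exists_eq_ofFn (w : Words m n) : ∃ (c : Fin n → Column) (d : Fin m → Letter),
    w = (TPow.ofFn c, TPow.ofFn d) := by
  obtain ⟨c, hc⟩ := TPow.ofFn_surjective w.1
  obtain ⟨d, hd⟩ := TPow.ofFn_surjective w.2
  exact ⟨c, d, Prod.ext hc.symm hd.symm⟩

/-- All cells are 1 ⊗ 2 or 1, and the height of a cell is determined by its place in the word. -/
lemma IsGood.eq_highestWord {w : Words m n} (h : w.IsGood)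
    (he : ∀ i, (wordCrystal m n).e i w = none) : w = highestWord m n := by
  obtain ⟨c, d, rfl⟩ := exists_eq_ofFn w
  have key := Cell.IsGood.forall_mem_of_listε_eq_zero h fun i => by
    rw [listε_cells, ε_eq_zero (he i)]
  rw [cells_ofFn, List.forall_mem_ofFn_iff] at key
  have hc : c = fun _ => ⟨(Letter.one, Letter.two), .refl _⟩ := by
    funext j
    have := key (Fin.castAdd m j)
    rw [Fin.append_left] at this
    rcases this with h | h
    · exact Cell.ofColumn_injective h
    · exact absurd (congrArg Prod.fst h) (by simp [Cell.ofColumn])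
  have hd : d = fun _ => Letter.one := by
    funext j
    have := key (Fin.natAdd n j)
    rw [Fin.append_right] at this
    rcases this with h | h
    · exact absurd (congrArg Prod.fst h) (by simp [Cell.ofLetter])
    · exact Cell.ofLetter_injective h
  rw [hc, hd]
  rfl

lemma isGood_highestWord : (highestWord m n).IsGood := by
  rw [IsGood, highestWord, cells_ofFn]
  have hl : ∀ j, Fin.append (Cell.ofColumn ∘ fun _ : Fin n => ⟨(Letter.one, Letter.two), .refl _⟩)
      (Cell.ofLetter ∘ fun _ : Fin m => Letter.one) j =
        if (j : ℕ) < n then (some .one, .two) else (none, .one) := by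
    intro j
    refine Fin.addCases (fun j => ?_) (fun j => ?_) j
    · simp [Cell.ofColumn]
    · simp [Cell.ofLetter]
  refine ⟨List.forall_mem_ofFn_iff.2 fun j => ?_, ?_⟩
  · rw [hl]
    split_ifs <;> decide
  · refine List.isChain_iff_pairwise.2 (List.pairwise_ofFn.2 fun j k hjk => ?_)
    rw [hl, hl]
    have : (j : ℕ) < k := hjk
    split_ifs <;> first | omega | decide

/-- Good words and their monomials are connected to the highest weight vectors. -/
lemma IsGood.connected {w : Words m n} (h : w.IsGood) :
    (wordCrystal m n).Connected (highestWord m n) w ∧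
      Monomial.crystal.Connected (highestWord m n).monomial w.monomial := by
  induction hr : w.rank using Nat.strong_induction_on generalizing w with
  | _ r ih =>
    by_cases he : ∀ i, (wordCrystal m n).e i w = none
    · rw [h.eq_highestWord he]
      exact ⟨.refl _, .refl _⟩
    · push Not at he
      obtain ⟨i, hi⟩ := he
      obtain ⟨v, hv⟩ := Option.ne_none_iff_exists'.1 hi
      obtain ⟨h1, h2⟩ := ih v.rank (hr ▸ rank_lt hv) (h.e hv) rfl
      have hf := ((wordCrystal m n).f_iff i _ _).2 hv
      refine ⟨h1.of_f hf, h2.of_f (i := i) ?_⟩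
      exact ((h.e hv).f_monomial i).trans (by rw [hf]; rfl)

lemma isGood_iff_connected {w : Words m n} :
    w.IsGood ↔ (wordCrystal m n).Connected (highestWord m n) w :=
  ⟨fun h => h.connected.1, fun h => (h.iff_of_stable (p := IsGood)
    (fun _ _ _ h' h => h.e h') (fun _ _ _ h' h => h.f h')).1 isGood_highestWord⟩

lemma IsGood.eq_of_monomial_eq {w w' : Words m n} (h : w.IsGood) (h' : w'.IsGood)
    (heq : w.monomial = w'.monomial) : w = w' := by
  induction hr : w.rank using Nat.strong_induction_on generalizing w w' with
  | _ r ih =>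
    have key : ∀ i, ((wordCrystal m n).e i w).map monomial =
        ((wordCrystal m n).e i w').map monomial := fun i => by
      rw [← h.e_monomial, ← h'.e_monomial, heq]
    by_cases he : ∀ i, (wordCrystal m n).e i w = none
    · rw [h.eq_highestWord he, h'.eq_highestWord fun i => ?_]
      have := key i
      rw [he i] at this
      exact Option.map_eq_none_iff.1 this.symm
    · push Not at he
      obtain ⟨i, hi⟩ := he
      obtain ⟨v, hv⟩ := Option.ne_none_iff_exists'.1 hi
      have hk := key i
      rw [hv] at hk
      obtain ⟨v', hv', hvv'⟩ := Option.map_eq_some_iff.1 hk.symm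
      obtain rfl := ih v.rank (hr ▸ rank_lt hv) (h.e hv) (h'.e hv') hvv'.symm rfl
      have h1 := ((wordCrystal m n).f_iff i _ _).2 hv
      have h2 := ((wordCrystal m n).f_iff i _ _).2 hv'
      exact Option.some.inj (h1.symm.trans h2)

/-- The monomials of good words are closed under the operators and include the highest one, so they
exhaust its component. -/
lemma exists_isGood_of_connected {M : Monomial}
    (h : Monomial.crystal.Connected (highestWord m n).monomial M) :
    ∃ w : Words m n, w.IsGood ∧ w.monomial = M := by
  refine (h.iff_of_stable (p := fun M => ∃ w : Words m n, w.IsGood ∧ w.monomial = M)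
    ?_ ?_).1 ⟨_, isGood_highestWord, rfl⟩
  · rintro i _ N hN ⟨w, hw, rfl⟩
    obtain ⟨v, hv, rfl⟩ := Option.map_eq_some_iff.1 ((hw.e_monomial i).symm.trans hN)
    exact ⟨v, hw.e hv, rfl⟩
  · rintro i _ N hN ⟨w, hw, rfl⟩
    obtain ⟨v, hv, rfl⟩ := Option.map_eq_some_iff.1 ((hw.f_monomial i).symm.trans hN)
    exact ⟨v, hw.f hv, rfl⟩

end Words

/-! ### Tableau conditions as conditions on lists of cells -/

namespace Filling

variable {m n : ℕ}

/-- The cells of a filling. -/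
def cell (T : Filling m n) (k : Fin (n + m)) : Cell :=
  (if h : (k : ℕ) < n then some (T.top ⟨k, h⟩) else none, T.bot k)

lemma cell_castAdd (T : Filling m n) (j : Fin n) :
    T.cell (Fin.castAdd m j) = (some (T.top j), T.bot (Fin.castAdd m j)) := by
  simp [cell]

lemma cell_natAdd (T : Filling m n) (k : Fin m) :
    T.cell (Fin.natAdd n k) = (none, T.bot (Fin.natAdd n k)) := by
  simp [cell]

lemma IsTableau.isGood {T : Filling m n} (h : T.IsTableau) : Cell.IsGood (List.ofFn T.cell) := by
  have hv : ∀ k, (T.cell k).Valid := by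
    intro k
    refine Fin.addCases (fun j => ?_) (fun j => ?_) k
    · rw [cell_castAdd]
      exact h.column j
    · rw [cell_natAdd]
      trivial
  refine ⟨List.forall_mem_ofFn_iff.2 hv, List.isChain_iff_getElem.2 fun k hk => ?_⟩
  rw [List.length_ofFn] at hk
  rw [List.getElem_ofFn, List.getElem_ofFn]
  refine ⟨hv _, hv _, ?_⟩
  have hb : Cell.RowCond (T.bot ⟨k, by omega⟩) (T.bot ⟨k + 1, hk⟩) :=
    ⟨h.bot_antitone (Fin.mk_le_mk.2 (by omega)), fun h' => by
      have := h.bot_zero _ _ h'.1 h'.2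
      simp at this⟩
  by_cases hn : k + 1 < n
  · have ht : Cell.RowCond (T.top ⟨k, by omega⟩) (T.top ⟨k + 1, hn⟩) :=
      ⟨h.top_antitone (Fin.mk_le_mk.2 (by omega)), fun h' => by
        have := h.top_zero _ _ h'.1 h'.2
        simp at this⟩
    have ha := h.adjacent ⟨k, by omega⟩ ⟨k + 1, hn⟩ rfl
    simp only [cell, hn, show k < n by omega, dif_pos]
    exact ⟨ht, hb, ha⟩
  -- The left cell has height one, so only the bottom row is constrained.
  · simp only [cell, hn, dif_neg, not_false_eq_true]
    split_ifs <;> exact hb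

lemma isTableau_of_isGood {T : Filling m n} (h : Cell.IsGood (List.ofFn T.cell)) :
    T.IsTableau := by
  -- Monotonicity and the single occurrence of 0 concern arbitrary pairs of columns, so the
  -- transitive form of the chain is used.
  have hp := List.pairwise_ofFn.1 h.pairwise
  have hb : ∀ j k, j < k → Cell.RowCond (T.bot j) (T.bot k) := by
    intro j k hjk
    have := (hp hjk).2.2
    rcases hc : T.cell j with ⟨_ | a, b⟩ <;> rcases hd : T.cell k with ⟨_ | a', b'⟩ <;>
      obtain rfl : T.bot j = b := congrArg Prod.snd hc <;>
      obtain rfl : T.bot k = b' := congrArg Prod.snd hd <;> rw [hc, hd] at this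
    · exact this
    · exact this.elim
    · exact this
    · exact this.2.1
  have ht : ∀ j k : Fin n, j < k → Cell.RowCond (T.top j) (T.top k) ∧
      AdjacentCond (T.top k) (T.bot (Fin.castAdd m j)) := by
    intro j k hjk
    have := (hp (show Fin.castAdd m j < Fin.castAdd m k from hjk)).2.2
    rw [cell_castAdd, cell_castAdd] at this
    exact ⟨this.1, this.2.2⟩
  refine ⟨antitone_iff_forall_lt.2 fun j k hjk => (ht j k hjk).1.1,
    antitone_iff_forall_lt.2 fun j k hjk => (hb j k hjk).1, fun j k hj hk => ?_,
    fun j k hj hk => ?_, fun j => ?_, fun j k hjk => (ht j k (Fin.lt_def.2 (by omega))).2⟩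
  · rcases lt_trichotomy j k with hjk | hjk | hjk
    · exact absurd ⟨hj, hk⟩ (ht j k hjk).1.2
    · exact hjk
    · exact absurd ⟨hk, hj⟩ (ht k j hjk).1.2
  · rcases lt_trichotomy j k with hjk | hjk | hjk
    · exact absurd ⟨hj, hk⟩ (hb j k hjk).2
    · exact hjk
    · exact absurd ⟨hk, hj⟩ (hb k j hjk).2
  · have := List.forall_mem_ofFn_iff.1 h.1 (Fin.castAdd m j)
    rw [cell_castAdd] at this
    exact this

/-- The product over the rows is regrouped by columns. -/
lemma listMonomial_cell (T : Filling m n) :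
    Cell.listMonomial (List.ofFn T.cell) = T.monomial := by
  rw [Cell.listMonomial, List.map_ofFn, List.prod_ofFn, Fin.prod_univ_add, monomial,
    Fin.prod_univ_add, ← mul_assoc, ← Finset.prod_mul_distrib]
  simp [cell_castAdd, cell_natAdd, Cell.monomial, Cell.topMonomial]

end Filling

/-! ### The reading of tableaux -/

namespace Tableau

variable {m n : ℕ}

lemma cells_read (T : Tableau m n) : T.read.cells = List.ofFn T.1.cell := by
  rw [read, Words.cells_ofFn]
  congr 1
  funext k
  refine Fin.addCases (fun j => ?_) (fun j => ?_) k
  · rw [Fin.append_left, Filling.cell_castAdd]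
    rfl
  · rw [Fin.append_right, Filling.cell_natAdd]
    rfl

lemma isGood_read (T : Tableau m n) : T.read.IsGood := by
  rw [Words.IsGood, cells_read]
  exact T.2.isGood

lemma monomial_read (T : Tableau m n) : T.read.monomial = T.1.monomial := by
  rw [Words.monomial, cells_read, Filling.listMonomial_cell]

lemma exists_read_eq {w : Words m n} (h : w.IsGood) : ∃ T : Tableau m n, T.read = w := by
  obtain ⟨c, d, rfl⟩ := Words.exists_eq_ofFn w
  let F : Filling m n := ⟨fun j => (c j).1.1, Fin.append (fun j => (c j).1.2) d⟩
  have hF : Fin.append (Cell.ofColumn ∘ c) (Cell.ofLetter ∘ d) = F.cell := by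
    funext k
    refine Fin.addCases (fun j => ?_) (fun j => ?_) k
    · rw [Fin.append_left, Filling.cell_castAdd]
      simp [F, Cell.ofColumn]
    · rw [Fin.append_right, Filling.cell_natAdd]
      simp [F, Cell.ofLetter]
  rw [Words.IsGood, Words.cells_ofFn, hF] at h
  refine ⟨⟨F, Filling.isTableau_of_isGood h⟩, Prod.ext ?_ ?_⟩
  · refine congrArg TPow.ofFn (funext fun j => Subtype.ext ?_)
    simp [F]
  · refine congrArg TPow.ofFn (funext fun j => ?_)
    simp [F]

lemma range_read : Set.range (@read m n) = {w | w.IsGood} := by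
  ext w
  exact ⟨fun ⟨T, hT⟩ => hT ▸ T.isGood_read, fun h => exists_read_eq h⟩

/-- An induced operator is `none` also when the result leaves the image of the reading. This never
happens, since the image consists of the good words, which are closed under the operators. -/
lemma read_strict : (tableauCrystal m n).IsStrictMorphism (wordCrystal m n) read where
  wt _ := rfl
  ε _ _ := rfl
  φ _ _ := rfl
  e i T := by
    simp only [tableauCrystal, pullback]
    split_ifs with h
    · exact h.choose_spec
    · rcases he : (wordCrystal m n).e i T.read with _ | w
      · rfl
      · obtain ⟨T', rfl⟩ := exists_read_eq (T.isGood_read.e he)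
        exact absurd ⟨T', he⟩ h
  f i T := by
    simp only [tableauCrystal, pullback]
    split_ifs with h
    · exact h.choose_spec
    · rcases hf : (wordCrystal m n).f i T.read with _ | w
      · rfl
      · obtain ⟨T', rfl⟩ := exists_read_eq (T.isGood_read.f hf)
        exact absurd ⟨T', hf⟩ h

lemma monomial_strict :
    (tableauCrystal m n).IsStrictMorphism Monomial.crystal fun T => T.1.monomial where
  wt T := by
    rw [← read_strict.wt, ← monomial_read]
    exact Words.wt_monomial _
  ε i T := by
    rw [← read_strict.ε, ← monomial_read]
    exact T.isGood_read.ε_monomial i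
  φ i T := by
    rw [← read_strict.φ, ← monomial_read]
    exact T.isGood_read.φ_monomial i
  e i T := by
    have h1 := T.isGood_read.e_monomial i
    rw [read_strict.e, Option.map_map, monomial_read] at h1
    refine h1.trans (congrArg (Option.map · _) (funext fun T => T.monomial_read))
  f i T := by
    have h1 := T.isGood_read.f_monomial i
    rw [read_strict.f, Option.map_map, monomial_read] at h1
    refine h1.trans (congrArg (Option.map · _) (funext fun T => T.monomial_read))

end Tableau

/-! ### The isomorphism between tableaux and monomials -/

lemma monomial_highestWord (m n : ℕ) : (highestWord m n).monomial = Monomial.highest m n := by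
  rw [Words.monomial, highestWord, Words.cells_ofFn, Cell.listMonomial, List.map_ofFn,
    List.prod_ofFn, Fin.prod_univ_add]
  -- In the column 1 ⊗ 2 the factor Y_1(2) of X_1(2) cancels against X_2(1), leaving Y_2(1).
  simp [Cell.ofColumn, Cell.ofLetter, Cell.monomial, Cell.topMonomial, Monomial.X,
    Monomial.highest, mul_comm]

/-- A map into a connected component is strict if its composition with the inclusion is. -/
lemma Crystal.IsStrictMorphism.codRestrict {A B : Type*} {C : Crystal A} {D : Crystal B} {b : B}
    {g : A → D.Component b} (hg : C.IsStrictMorphism D (Subtype.val ∘ g)) :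
    C.IsStrictMorphism (D.component b) g where
  wt := hg.wt
  ε := hg.ε
  φ := hg.φ
  e i a := by
    apply Option.map_injective Subtype.val_injective
    rw [← (component_strict D b).e, Option.map_map]
    exact hg.e i a
  f i a := by
    apply Option.map_injective Subtype.val_injective
    rw [← (component_strict D b).f, Option.map_map]
    exact hg.f i a

lemma Crystal.IsStrictMorphism.symm {A B : Type*} {C : Crystal A} {D : Crystal B} {g : A ≃ B}
    (hg : C.IsStrictMorphism D g) : D.IsStrictMorphism C g.symm where
  wt b := by rw [← hg.wt, g.apply_symm_apply]
  ε i b := by rw [← hg.ε, g.apply_symm_apply]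
  φ i b := by rw [← hg.φ, g.apply_symm_apply]
  e i b := by
    have h := hg.e i (g.symm b)
    rw [g.apply_symm_apply] at h
    simp [h, Function.comp_def]
  f i b := by
    have h := hg.f i (g.symm b)
    rw [g.apply_symm_apply] at h
    simp [h, Function.comp_def]

namespace Tableau

variable {m n : ℕ}

/-- The monomial of a tableau, as an element of `M(m Λ₁ + n Λ₂)`. -/
noncomputable def toComp (T : Tableau m n) : Monomial.Comp m n :=
  ⟨T.1.monomial, by
    have := T.isGood_read.connected.2
    rwa [monomial_read, monomial_highestWord] at this⟩

lemma toComp_bijective : Function.Bijective (@toComp m n) := by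
  refine ⟨fun S T h => ?_, fun M => ?_⟩
  · apply read_injective
    apply S.isGood_read.eq_of_monomial_eq T.isGood_read
    rw [monomial_read, monomial_read]
    exact congrArg Subtype.val h
  · obtain ⟨w, hw, hM⟩ := Words.exists_isGood_of_connected (m := m) (n := n)
      (by rw [monomial_highestWord]; exact M.2)
    obtain ⟨T, rfl⟩ := exists_read_eq hw
    exact ⟨T, Subtype.ext (T.monomial_read.symm.trans hM)⟩

end Tableau
end G2

theorem mainTheorem2 (m n : ℕ) :
    ((G2.tableauCrystal m n).IsStrictMorphism (G2.wordCrystal m n) G2.Tableau.read ∧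
      Set.range (@G2.Tableau.read m n) =
        {w | (G2.wordCrystal m n).Connected (G2.highestWord m n) w}) ∧
    ∃ ψ : G2.Monomial.Comp m n ≃ G2.Tableau m n,
      (G2.Monomial.compCrystal m n).IsStrictMorphism (G2.tableauCrystal m n) ψ ∧
      ∀ (M : G2.Monomial.Comp m n) (T : G2.Tableau m n),
        ψ M = T ↔ (M : G2.Monomial) = T.1.monomial := by
  -- With ψ defined as the inverse of the monomial map, the characterization of `ψ M = T` holds by
  -- construction.
  let g := Equiv.ofBijective _ (G2.Tableau.toComp_bijective (m := m) (n := n))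
  refine ⟨⟨G2.Tableau.read_strict, ?_⟩, g.symm, ?_, fun M T => ?_⟩
  · rw [G2.Tableau.range_read]
    ext w
    exact G2.Words.isGood_iff_connected
  · exact G2.Crystal.IsStrictMorphism.symm
      (G2.Crystal.IsStrictMorphism.codRestrict G2.Tableau.monomial_strict)
  · rw [Equiv.symm_apply_eq, Subtype.ext_iff]
    rfl
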